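/- Let $\Omega=\{X_r : r\in\mathbf Q\cup\{\tfrac10\}\}$ be the set of complementary regions of the binary tree $\Sigma$ dual to the Farey tessellation. Write elements of $\mathbf Q\cup\{\tfrac10\}$ in lowest terms with non-negative denominator; $\frac pq$ and $\frac{p'}{q'}$ are Farey neighbors if $|pq'-p'q|=1$. Three regions meet at a vertex of $\Sigma$ iff their indices are pairwise Farey neighbors, and $e\leftrightarrow(X,Y;Z,W)$ means that $X\cap Y=e$ is an edge of $\Sigma$ and that $X,Y,Z$ and $X,Y,W$ (with $Z\ne W$) are the regions meeting at its two endpoints. For $\mu\in\mathbf C$, a $\mu$-Markoff map is a map $\phi:\Omega\to\mathbf C$ such that $\phi(X)^2+\phi(Y)^2+\phi(Z)^2-\phi(X)\phi(Y)\phi(Z)=\mu$ whenever $X,Y,Z$ meet at a vertex, and $\phi(X)\phi(Y)=\phi(Z)+\phi(W)$ for every edge $e\leftrightarrow(X,Y;Z,W)$. Let $\sqrt{\cdot}$ be the principal square root (positive real part off $(-\infty,0]$, positive imaginary part on $(-\infty,0)$), let $\log$ have imaginary part in $(-\pi,\pi]$, and let $\cosh^{-1}$ have real part $\ge 0$ and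 imaginary part in $(-\pi,\pi]$, with imaginary part in $[0,\pi]$ when the real part is $0$. Put $$h(x)=\tfrac12\Bigl(1-\sqrt{1-4/x^2}\Bigr)\ (x\ne0),\qquad \nu=\cosh^{-1}(1-\mu/2),\qquad \mathfrak h_{\mu-2}(x)=\log\frac{1+(e^{\nu}-1)h(x)}{1+(e^{-\nu}-1)h(x)}\ \ (x\neq 0,\ x^2\ne\mu),$$ and let $\mathfrak h=h$ if $\mu=0$ and $\mathfrak h=\mathfrak h_{\mu-2}$ if $\mu\ne0$. **Theorem.** Let $\mu\in\mathbf C$, $\mu\neq4$, and let $\phi$ be a $\mu$-Markoff map such that $X_{1/0}$ is the only region $X\in\Omega$ with $|\phi(X)|\le2$, and such that $\phi(X_{1/0})$ is a real number in $(-2,2)$. Then $\phi(X_r)\ne0$ and $\phi(X_r)^2\neq\mu$ for all $r\in\mathbf Q$ (so that every $\mathfrak h(\phi(X_r))$ is defined), the series $\sum_{r\in\mathbf Q\cap(0,N]}\mathfrak h(\phi(X_r))$ converges absolutely for every positive integer $N$, and $$\lim_{N\to\infty}\Re\Bigl(\frac1N\sum_{r\in\mathbf Q\cap(0,N]}\mathfrak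 h(\phi(X_r))\Bigr)=0,$$ where $N$ runs over the positive integers. Moreover there is a strictly increasing sequence $(N_k)_{k\ge1}$ of positive integers such that $$\lim_{k\to\infty}\ \sum_{r\in\mathbf Q\cap(0,N_k]}\mathfrak h(\phi(X_r))=0\mod 2\pi i,$$ that is, there are integers $m_k$ such that $\sum_{r\in\mathbf Q\cap(0,N_k]}\mathfrak h(\phi(X_r))-2\pi i\,m_k\to0$ as $k\to\infty$. -/

import Mathlib

noncomputable section

namespace MarkoffMap

/-! ## Complementary regions of the tree dual to the Farey tessellation -/

/-- The set `Ω` of complementary regions of the binary tree dual to the Farey tessellation,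
identified with `ℚ ∪ {1/0}`. The region `X_{1/0}` is `OnePoint.infty`, and `X_r` is the
coercion of `r : ℚ`. -/
abbrev Region : Type := OnePoint ℚ

/-- Numerator in lowest terms, with the convention `∞ = 1/0`. -/
def Region.num : Region → ℤ
  | none => 1
  | some r => r.num

/-- Denominator in lowest terms, with the convention `∞ = 1/0`. -/
def Region.den : Region → ℤ
  | none => 0
  | some r => (r.den : ℤ)

/-- `p/q` and `p'/q'` are Farey neighbors if `|p q' - p' q| = 1`. The two regions then share
an edge of the tree. -/
def FareyNeighbor (X Y : Region) : Prop :=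
  |X.num * Y.den - Y.num * X.den| = 1

/-- `X, Y, Z` are the three regions meeting at a vertex of the tree (the vertices of the tree are
the triangles of the Farey tessellation). -/
def MeetAtVertex (X Y Z : Region) : Prop :=
  FareyNeighbor X Y ∧ FareyNeighbor Y Z ∧ FareyNeighbor X Z

/-- The relation `e ↔ (X, Y; Z, W)`: `e = X ∩ Y` is an edge of the tree, and its two
endpoints are `e ∩ Z` and `e ∩ W`. -/
def EdgeRegions (X Y Z W : Region) : Prop :=
  MeetAtVertex X Y Z ∧ MeetAtVertex X Y W ∧ Z ≠ W

/-- `φ : Ω → ℂ` is a `μ`-Markoff map. -/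
structure IsMarkoffMap (μ : ℂ) (φ : Region → ℂ) : Prop where
  vertex : ∀ X Y Z : Region, MeetAtVertex X Y Z →
    φ X ^ 2 + φ Y ^ 2 + φ Z ^ 2 - φ X * φ Y * φ Z = μ
  edge : ∀ X Y Z W : Region, EdgeRegions X Y Z W → φ X * φ Y = φ Z + φ W

/-- `Ω_φ(k)`, the set of regions on which `|φ| ≤ k`. -/
def sublevel (φ : Region → ℂ) (k : ℝ) : Set Region :=
  {X | ‖φ X‖ ≤ k}

/-! ## The gap functions -/

/-- `h(x) = (1 - √(1 - 4/x²)) / 2`, for `x ≠ 0`, with the principal square root. -/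
def gapH (x : ℂ) : ℂ :=
  (1 - Complex.sqrt (1 - 4 / x ^ 2)) / 2

/-- The principal inverse hyperbolic cosine; its values are pinned down by `cosh_arccosh`,
`arccosh_re_nonneg`, `arccosh_im_mem` and `arccosh_im_nonneg` below. -/
def arccosh (u : ℂ) : ℂ :=
  Complex.log (u + Complex.sqrt (u + 1) * Complex.sqrt (u - 1))

/-- `ν = cosh⁻¹(1 - μ/2) = cosh⁻¹(-τ/2)`, where `τ = μ - 2`. -/
def nu (μ : ℂ) : ℂ := arccosh (1 - μ / 2)

/-- `𝔥_τ(x) = log ((1 + (e^ν - 1) h(x)) / (1 + (e^{-ν} - 1) h(x)))` with `τ = μ - 2`, written in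
terms of `μ`, for `μ ≠ 0, 4` and `x ≠ 0`, `x² ≠ μ`. -/
def gapTau (μ x : ℂ) : ℂ :=
  Complex.log ((1 + (Complex.exp (nu μ) - 1) * gapH x) /
    (1 + (Complex.exp (-nu μ) - 1) * gapH x))

open Classical in
/-- `𝔥 = h` if `μ = 0`, and `𝔥 = 𝔥_{μ-2}` if `μ ≠ 0`. -/
def gap (μ x : ℂ) : ℂ := if μ = 0 then gapH x else gapTau μ x

/-- The index set `ℚ ∩ (0, N]`. -/
def ratIoc (N : ℕ) : Set ℚ := Set.Ioc 0 (N : ℚ)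

/-- `∑_{r ∈ ℚ ∩ (0, N]} 𝔥(φ(X_r))`. -/
def gapSum (μ : ℂ) (φ : Region → ℂ) (N : ℕ) : ℂ :=
  ∑' r : ratIoc N, gap μ (φ ((r : ℚ) : Region))

/-! ## The branch of `cosh⁻¹` -/

theorem sqrt_sq (u : ℂ) : Complex.sqrt u ^ 2 = u := by
  unfold Complex.sqrt
  exact_mod_cast Complex.cpow_nat_inv_pow u two_ne_zero

theorem sqrt_mul_self (u : ℂ) : Complex.sqrt u * Complex.sqrt u = u := by
  rw [← sq, sqrt_sq]

theorem arccosh_arg_mul (u : ℂ) :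
    (u + Complex.sqrt (u + 1) * Complex.sqrt (u - 1)) *
      (u - Complex.sqrt (u + 1) * Complex.sqrt (u - 1)) = 1 := by
  linear_combination (-(Complex.sqrt (u - 1)) ^ 2) * sqrt_sq (u + 1) - (u + 1) * sqrt_sq (u - 1)

theorem cosh_arccosh (u : ℂ) : Complex.cosh (arccosh u) = u := by
  have h := arccosh_arg_mul u
  have h0 := left_ne_zero_of_mul_eq_one h
  rw [Complex.cosh, Complex.exp_neg, arccosh, Complex.exp_log h0, inv_eq_of_mul_eq_one_right h]
  ring

theorem arccosh_im_mem (u : ℂ) : (arccosh u).im ∈ Set.Ioc (-Real.pi) Real.pi :=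
  ⟨Complex.neg_pi_lt_log_im _, Complex.log_im_le_pi _⟩

theorem sqrt_re_nonneg (u : ℂ) : 0 ≤ (Complex.sqrt u).re := by
  rcases eq_or_ne u 0 with rfl | hu
  · simp
  · unfold Complex.sqrt
    rw [Complex.cpow_def_of_ne_zero hu, Complex.exp_re]
    have h1 := Complex.neg_pi_lt_log_im u
    have h2 := Complex.log_im_le_pi u
    have h3 : (Complex.log u * 2⁻¹).im = (Complex.log u).im / 2 := by
      rw [Complex.mul_im]; norm_num; ring
    rw [h3]
    exact mul_nonneg (Real.exp_pos _).le
      (Real.cos_nonneg_of_mem_Icc ⟨by linarith, by linarith⟩)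

theorem im_eq_two_mul_sqrt (u : ℂ) :
    u.im = 2 * ((Complex.sqrt u).re * (Complex.sqrt u).im) := by
  conv_lhs => rw [← sqrt_mul_self u]
  rw [Complex.mul_im]; ring

theorem re_eq_sqrt (u : ℂ) :
    u.re = (Complex.sqrt u).re ^ 2 - (Complex.sqrt u).im ^ 2 := by
  conv_lhs => rw [← sqrt_mul_self u]
  rw [Complex.mul_re]; ring

/-- On the closed negative half-line the principal root has non-negative imaginary part. -/
theorem sqrt_im_nonneg_of_im_eq_zero (u : ℂ) (hu : u.im = 0) : 0 ≤ (Complex.sqrt u).im := by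
  rcases eq_or_ne u 0 with rfl | h0
  · simp
  · unfold Complex.sqrt
    rw [Complex.cpow_def_of_ne_zero h0, Complex.exp_im]
    have h3 : (Complex.log u * 2⁻¹).im = (Complex.log u).im / 2 := by
      rw [Complex.mul_im]; norm_num; ring
    have h4 : 0 ≤ (Complex.log u).im := by
      rw [Complex.log_im, Complex.arg_nonneg_iff, hu]
    have h2 := Complex.log_im_le_pi u
    rw [h3]
    exact mul_nonneg (Real.exp_pos _).le
      (Real.sin_nonneg_of_nonneg_of_le_pi (by linarith) (by linarith [Real.pi_pos]))

theorem sqrt_im_mul_nonneg (u : ℂ) :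
    0 ≤ (Complex.sqrt (u + 1)).re * (Complex.sqrt (u - 1)).re +
      (Complex.sqrt (u + 1)).im * (Complex.sqrt (u - 1)).im := by
  have ha := sqrt_re_nonneg (u + 1)
  have hb := sqrt_re_nonneg (u - 1)
  have ia := im_eq_two_mul_sqrt (u + 1)
  have ib := im_eq_two_mul_sqrt (u - 1)
  simp only [Complex.add_im, Complex.sub_im, Complex.one_im, add_zero, sub_zero] at ia ib
  refine add_nonneg (mul_nonneg ha hb) ?_
  rcases lt_trichotomy u.im 0 with h | h | h
  · have h1 : (Complex.sqrt (u + 1)).im < 0 := by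
      by_contra hc; push Not at hc; nlinarith [mul_nonneg ha hc]
    have h2 : (Complex.sqrt (u - 1)).im < 0 := by
      by_contra hc; push Not at hc; nlinarith [mul_nonneg hb hc]
    exact (mul_pos_of_neg_of_neg h1 h2).le
  · exact mul_nonneg (sqrt_im_nonneg_of_im_eq_zero _ (by simp [h]))
      (sqrt_im_nonneg_of_im_eq_zero _ (by simp [h]))
  · have h1 : 0 < (Complex.sqrt (u + 1)).im := by
      by_contra hc; push Not at hc; nlinarith [mul_nonneg ha (neg_nonneg.2 hc)]
    have h2 : 0 < (Complex.sqrt (u - 1)).im := by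
      by_contra hc; push Not at hc; nlinarith [mul_nonneg hb (neg_nonneg.2 hc)]
    exact (mul_pos h1 h2).le

theorem arccosh_re_nonneg (u : ℂ) : 0 ≤ (arccosh u).re := by
  rw [arccosh, Complex.log_re]
  apply Real.log_nonneg
  set a := Complex.sqrt (u + 1) with ha
  set b := Complex.sqrt (u - 1) with hb
  have h1 : u + a * b = (a + b) ^ 2 / 2 := by
    linear_combination (-1 / 2 : ℂ) * sqrt_sq (u + 1) - (1 / 2 : ℂ) * sqrt_sq (u - 1)
  have h2 : (a + b) * (a - b) = 2 := by
    linear_combination sqrt_sq (u + 1) - sqrt_sq (u - 1)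
  have h3 : 0 ≤ a.re * b.re + a.im * b.im := sqrt_im_mul_nonneg u
  have h4 : ‖a + b‖ * ‖a - b‖ = 2 := by rw [← norm_mul, h2]; norm_num
  have h5 : ‖a - b‖ ^ 2 ≤ ‖a + b‖ ^ 2 := by
    rw [← Complex.normSq_eq_norm_sq, ← Complex.normSq_eq_norm_sq, Complex.normSq_apply,
      Complex.normSq_apply]
    simp only [Complex.add_re, Complex.add_im, Complex.sub_re, Complex.sub_im]
    nlinarith
  have h6 : ‖a - b‖ ≤ ‖a + b‖ := (sq_le_sq₀ (norm_nonneg _) (norm_nonneg _)).1 h5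
  rw [h1, norm_div, norm_pow]
  norm_num
  nlinarith [norm_nonneg (a + b)]

/-- If `cosh⁻¹ u` is purely imaginary, its imaginary part lies in `[0, π]`. -/
theorem arccosh_im_nonneg (u : ℂ) (h : (arccosh u).re = 0) : 0 ≤ (arccosh u).im := by
  have hc : arccosh u = ((arccosh u).im : ℂ) * Complex.I := by
    apply Complex.ext <;> simp [h]
  have hu : u = ((Real.cos (arccosh u).im : ℝ) : ℂ) := by
    conv_lhs => rw [← cosh_arccosh u, hc, Complex.cosh_mul_I]
    simp
  have him : u.im = 0 := by rw [hu]; exact Complex.ofReal_im _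
  have hre : u.re = Real.cos (arccosh u).im := by
    conv_lhs => rw [hu]
    exact Complex.ofReal_re _
  have hle : u.re ≤ 1 := hre ▸ Real.cos_le_one _
  rw [arccosh, Complex.log_im, Complex.arg_nonneg_iff, Complex.add_im, him, Complex.mul_im]
  have ia := im_eq_two_mul_sqrt (u - 1)
  have rb := re_eq_sqrt (u - 1)
  simp only [Complex.sub_im, Complex.one_im, sub_zero, him, Complex.sub_re, Complex.one_re] at ia rb
  have hz : (Complex.sqrt (u - 1)).re = 0 := by
    rcases mul_eq_zero.1 (show (Complex.sqrt (u - 1)).re * (Complex.sqrt (u - 1)).im = 0 by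
      linarith) with h0 | h0
    · exact h0
    · rw [h0] at rb
      nlinarith [sq_nonneg (Complex.sqrt (u - 1)).re]
  rw [hz]
  have := mul_nonneg (sqrt_re_nonneg (u + 1))
    (sqrt_im_nonneg_of_im_eq_zero (u - 1) (by simp [him]))
  linarith

end MarkoffMap

end

/-!
# Gap sums of Markoff maps along a region of elliptic type

Fix an edge of the tree with regions `x`, `y` on its two sides, `z` at one end and `w = x y - z` at
the other, and put `H_ω(x) = 1 + (ω - 1) h(x)` with `ω = e^ν`, so that `exp 𝔥 = H_ω / H_{ω⁻¹}`. The
vertex and edge relations say that the edge weight `R = (1 + (ω - 1) z / (x y)) / (H_ω(x) H_ω(y))`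
of the edge leading to `w` equals `exp 𝔥(w)` times the product of the weights of the two edges that
leave `w` (`TamePair.edgeWeight_eq_mul`). Iterating, `R` is the product of `exp 𝔥` over the regions
met so far and of the weights of the current edges. If `x` and `y` exceed `2` in modulus and
`|z| ≤ |w|`, then `|φ| / 2` is supermultiplicative under mediants beyond the edge, hence
exponential in the denominator (`GrowthPair.le_mediant`), and `R - 1` decays like `1 / (x y)²`. At
the edge between the regions `n` and `n + 1` these conditions hold, because `z` is `φ(1/0)`, the
only value in the disc of radius `2`. So the weights drop out in the limit, and `R` is the product
of `exp 𝔥` over all regions beyond the edge (`exists_hasSum_of_telescoping`,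
`exists_hasSum_exp_eq_edgeWeight`). For `μ = 0` the same argument applies additively to
`z / (x y) - h(x) - h(y)` (`hasSum_two_mul_gapH`).

Let `t = φ(1/0) = 2 cos θ` and `y n = φ(n)`, so that `y (n+1) = t y n - y (n-1)`. Taking the
product over the Farey intervals `(n, n + 1)` and the integers, everything telescopes:
`exp (∑_{(0,N]} 𝔥) = B N / B 0`, where `B n = K n / (y n H_{ω⁻¹}(y n))` and
`K n = t y n + (ω - 1) y (n+1)` (`recurrentSums_of_exp_eq`). If `K` vanishes, `ω⁻¹` is used in
place of `ω`, and for `μ = 0` the logarithmic derivative of `B` takes its place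
(`recurrentSums_gapH`). Solutions of the recurrence are rotated by the angle `θ`, hence bounded,
and they return arbitrarily close to their initial values. Since
`y (n-1) y (n+1) = y n ^ 2 + t ^ 2 - μ` keeps `y n ^ 2` away from `μ`, `B` is bounded above and
below, which gives the limit of the averages, and `B` returns to `B 0` along a subsequence, which
gives the second limit.
-/

namespace MarkoffMap

open Filter Topology

/-! ### Farey pairs and sums over the tree of mediants -/

/-- `a < b` are consecutive fractions: `a = p/q`, `b = p'/q'` in lowest terms with
`p' q - p q' = 1`. -/
def FareyPair (a b : ℚ) : Prop := b.num * a.den - a.num * b.den = 1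

/-- The mediant `(p + p') / (q + q')` of `p/q` and `p'/q'`. -/
def mediant (a b : ℚ) : ℚ := ((a.num + b.num : ℤ) : ℚ) / ((a.den + b.den : ℕ) : ℚ)

namespace FareyPair

variable {a b : ℚ}

theorem mediant_num_den (h : FareyPair a b) :
    (mediant a b).num = a.num + b.num ∧ (mediant a b).den = a.den + b.den := by
  unfold FareyPair at h
  have hpos : (0 : ℤ) < ((a.den + b.den : ℕ) : ℤ) := by
    have := a.den_pos; omega
  have hc : Nat.Coprime (a.num + b.num).natAbs ((a.den + b.den : ℕ) : ℤ).natAbs := by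
    rw [← Int.isCoprime_iff_nat_coprime]
    refine ⟨-(b.den : ℤ), b.num, ?_⟩
    push_cast
    linear_combination h
  have h1 := Rat.num_div_eq_of_coprime hpos hc
  have h2 := Rat.den_div_eq_of_coprime hpos hc
  unfold mediant
  push_cast at h1 h2 ⊢
  exact ⟨h1, by exact_mod_cast h2⟩

theorem mediant_num (h : FareyPair a b) : (mediant a b).num = a.num + b.num :=
  h.mediant_num_den.1

theorem mediant_den (h : FareyPair a b) : (mediant a b).den = a.den + b.den :=
  h.mediant_num_den.2

theorem left (h : FareyPair a b) : FareyPair a (mediant a b) := by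
  unfold FareyPair at *
  rw [mediant_num h, mediant_den h]
  push_cast
  linear_combination h

theorem right (h : FareyPair a b) : FareyPair (mediant a b) b := by
  unfold FareyPair at *
  rw [mediant_num h, mediant_den h]
  push_cast
  linear_combination h

theorem sub_eq (h : FareyPair a b) : (b : ℝ) - a = 1 / ((a.den : ℝ) * b.den) := by
  have ha : (a.den : ℝ) ≠ 0 := by exact_mod_cast a.den_ne_zero
  have hb : (b.den : ℝ) ≠ 0 := by exact_mod_cast b.den_ne_zero
  have h' : (b.num : ℝ) * a.den - a.num * b.den = 1 := by exact_mod_cast h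
  rw [Rat.cast_def a, Rat.cast_def b]
  field_simp
  linear_combination h'

theorem lt (h : FareyPair a b) : a < b := by
  have h1 := h.sub_eq
  have : (0 : ℝ) < 1 / ((a.den : ℝ) * b.den) := by
    have := a.den_pos; have := b.den_pos; positivity
  have h2 : (a : ℝ) < b := by linarith
  exact_mod_cast h2

/-- A fraction strictly between Farey neighbors has denominator at least the sum of
theirs. -/
theorem den_add_le (h : FareyPair a b) {r : ℚ} (h1 : a < r) (h2 : r < b) :
    a.den + b.den ≤ r.den := by
  rw [Rat.lt_iff] at h1 h2
  unfold FareyPair at h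
  have e : (r.den : ℤ) = a.den * (b.num * r.den - r.num * b.den) +
      b.den * (r.num * a.den - a.num * r.den) := by linear_combination (-(r.den : ℤ)) * h
  have ha : (0 : ℤ) < a.den := by exact_mod_cast a.den_pos
  have hb : (0 : ℤ) < b.den := by exact_mod_cast b.den_pos
  have i1 : (1 : ℤ) ≤ b.num * r.den - r.num * b.den := by linarith
  have i2 : (1 : ℤ) ≤ r.num * a.den - a.num * r.den := by linarith
  zify
  nlinarith [mul_le_mul_of_nonneg_left i1 ha.le, mul_le_mul_of_nonneg_left i2 hb.le]

end FareyPair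

/-- A predicate on Farey pairs that is inherited by the two halves into which the mediant cuts
a pair. -/
structure FareyHereditary (P : ℚ → ℚ → Prop) : Prop where
  pair : ∀ {a b}, P a b → FareyPair a b
  left : ∀ {a b}, P a b → P a (mediant a b)
  right : ∀ {a b}, P a b → P (mediant a b) b

/-- Every rational strictly inside a Farey interval is reached by taking mediants. -/
theorem FareyHereditary.exists_eq_mediant {P : ℚ → ℚ → Prop} (hP : FareyHereditary P)
    {a b r : ℚ} (hab : P a b) (h1 : a < r) (h2 : r < b) :
    ∃ a' b', P a' b' ∧ r = mediant a' b' := by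
  induction hk : r.den - (a.den + b.den) using Nat.strong_induction_on generalizing a b with
  | _ k ih =>
    have hle := (hP.pair hab).den_add_le h1 h2
    have hm := (hP.pair hab).mediant_den
    have ha := a.den_pos
    have hb := b.den_pos
    rcases lt_trichotomy r (mediant a b) with h | h | h
    · have := (hP.pair (hP.left hab)).den_add_le h1 h
      exact ih _ (by omega) (hP.left hab) h1 h rfl
    · exact ⟨a, b, hab, h⟩
    · have := (hP.pair (hP.right hab)).den_add_le h h2
      exact ih _ (by omega) (hP.right hab) h h2 rfl

open Classical in
/-- The mediants obtained from the pair `a, b` in at most `n` generations. -/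
def mediants : ℕ → ℚ → ℚ → Finset ℚ
  | 0, _, _ => ∅
  | n + 1, a, b =>
    insert (mediant a b) (mediants n a (mediant a b) ∪ mediants n (mediant a b) b)

theorem mediants_subset {n : ℕ} {a b : ℚ} (h : FareyPair a b) :
    ∀ r ∈ mediants n a b, a < r ∧ r < b := by
  induction n generalizing a b with
  | zero => simp [mediants]
  | succ n ih =>
    intro r hr
    have h1 := h.left.lt
    have h2 := h.right.lt
    simp only [mediants, Finset.mem_insert, Finset.mem_union] at hr
    rcases hr with rfl | hr | hr
    · exact ⟨h1, h2⟩
    · exact ⟨(ih h.left r hr).1, (ih h.left r hr).2.trans h2⟩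
    · exact ⟨h1.trans (ih h.right r hr).1, (ih h.right r hr).2⟩

theorem mem_mediants {n : ℕ} {a b r : ℚ} (h : FareyPair a b) (h1 : a < r) (h2 : r < b)
    (hn : r.den < n + a.den + b.den) : r ∈ mediants n a b := by
  induction n generalizing a b with
  | zero => have := h.den_add_le h1 h2; omega
  | succ n ih =>
    simp only [mediants, Finset.mem_insert, Finset.mem_union]
    have hm := h.mediant_den
    have ha := a.den_pos
    have hb := b.den_pos
    rcases lt_trichotomy r (mediant a b) with h3 | h3 | h3
    · exact Or.inr (Or.inl (ih h.left h1 h3 (by omega)))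
    · exact Or.inl h3
    · exact Or.inr (Or.inr (ih h.right h3 h2 (by omega)))

theorem sum_mediants_succ {M : Type*} [AddCommMonoid M] (g : ℚ → M) (n : ℕ) {a b : ℚ}
    (h : FareyPair a b) :
    ∑ r ∈ mediants (n + 1) a b, g r = g (mediant a b) +
      (∑ r ∈ mediants n a (mediant a b), g r + ∑ r ∈ mediants n (mediant a b) b, g r) := by
  classical
  have h1 := mediants_subset (n := n) h.left
  have h2 := mediants_subset (n := n) h.right
  rw [mediants, Finset.sum_insert, Finset.sum_union]
  · rw [Finset.disjoint_left]
    intro r hr hr'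
    exact lt_asymm (h1 r hr).2 (h2 r hr').1
  · rw [Finset.mem_union]
    rintro (hr | hr)
    · exact lt_irrefl _ (h1 _ hr).2
    · exact lt_irrefl _ (h2 _ hr).1

/-- Geometric decay in `den a + den b` beats any power of it times `b - a = 1 / (den a * den b)`. -/
theorem exists_pow_le_div (β : ℝ) (h0 : 0 ≤ β) (h1 : β < 1) (j : ℕ) :
    ∃ C : ℝ, 0 ≤ C ∧ ∀ {a b : ℚ}, FareyPair a b →
      β ^ (a.den + b.den) ≤ C * (((b : ℝ) - a) / ((a.den : ℝ) + b.den) ^ j) := by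
  obtain ⟨C, hC⟩ := (tendsto_pow_const_mul_const_pow_of_lt_one (j + 2) h0 h1).bddAbove_range
  refine ⟨max C 0, le_max_right _ _, fun {a b} h => ?_⟩
  have hC' := (hC ⟨a.den + b.den, rfl⟩).trans (le_max_left C 0)
  simp only [Nat.cast_add] at hC'
  have ha : (0 : ℝ) < a.den := by exact_mod_cast a.den_pos
  have hb : (0 : ℝ) < b.den := by exact_mod_cast b.den_pos
  rw [h.sub_eq, div_div, mul_one_div, le_div_iff₀ (by positivity)]
  refine le_trans ?_ hC'
  rw [mul_comm, pow_add _ j 2]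
  refine mul_le_mul_of_nonneg_right ?_ (by positivity)
  rw [mul_comm]
  refine mul_le_mul_of_nonneg_left ?_ (by positivity)
  nlinarith

/-- Summability over a Farey interval. The bound decays faster than the inverse square of
`den a + den b`, and `1/k² + 1/k ≤ 1/(k-1)` together with additivity of the length `b - a`
bounds the partial sums over generations. -/
theorem summable_of_mediant_le {P : ℚ → ℚ → Prop} (hP : FareyHereditary P) {g : ℚ → ℝ}
    (hg : ∀ r, 0 ≤ g r) {β C : ℝ} (h0 : 0 ≤ β) (h1 : β < 1) (hC : 0 ≤ C)
    (hbound : ∀ {a b}, P a b → g (mediant a b) ≤ C * β ^ (a.den + b.den))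
    {a b : ℚ} (hab : P a b) : Summable fun r : Set.Ioo a b => g r := by
  obtain ⟨A, hA0, hA⟩ := exists_pow_le_div β h0 h1 2
  have key : ∀ n : ℕ, ∀ {a b : ℚ}, P a b → ∑ r ∈ mediants n a b, g r ≤
      C * A * (((b : ℝ) - a) / ((a.den : ℝ) + b.den - 1)) := by
    intro n
    induction n with
    | zero =>
      intro a b hab
      have ha : (1 : ℝ) ≤ a.den := by exact_mod_cast a.den_pos
      have hb : (1 : ℝ) ≤ b.den := by exact_mod_cast b.den_pos
      have hlt : (a : ℝ) < b := by exact_mod_cast (hP.pair hab).lt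
      simp only [mediants, Finset.sum_empty]
      have := sub_pos.2 hlt
      have : (0 : ℝ) < (a.den : ℝ) + b.den - 1 := by linarith
      positivity
    | succ n ih =>
      intro a b hab
      have hF := hP.pair hab
      have ha : (1 : ℝ) ≤ a.den := by exact_mod_cast a.den_pos
      have hb : (1 : ℝ) ≤ b.den := by exact_mod_cast b.den_pos
      have l1 : (a : ℝ) < mediant a b := by exact_mod_cast hF.left.lt
      have l2 : (mediant a b : ℝ) < b := by exact_mod_cast hF.right.lt
      have e1 := ih (hP.left hab)
      have e2 := ih (hP.right hab)
      rw [hF.mediant_den] at e1 e2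
      push_cast at e1 e2
      have e3 := (hbound hab).trans (mul_le_mul_of_nonneg_left (hA hF) hC)
      rw [sum_mediants_succ g n hF]
      set k : ℝ := (a.den : ℝ) + b.den with hk
      have hk2 : 2 ≤ k := by linarith
      have f1 : ((mediant a b : ℝ) - a) / ((a.den : ℝ) + k - 1) ≤
          ((mediant a b : ℝ) - a) / k :=
        div_le_div_of_nonneg_left (by linarith) (by linarith) (by linarith)
      have f2 : ((b : ℝ) - mediant a b) / (k + b.den - 1) ≤ ((b : ℝ) - mediant a b) / k :=
        div_le_div_of_nonneg_left (by linarith) (by linarith) (by linarith)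
      have f3 : ((b : ℝ) - a) / k ^ 2 + ((b : ℝ) - a) / k ≤ ((b : ℝ) - a) / (k - 1) := by
        rw [div_add_div _ _ (by positivity) (by positivity),
          div_le_div_iff₀ (by positivity) (by linarith)]
        have : 0 < (b : ℝ) - a := by linarith
        nlinarith [mul_pos this (show 0 < k by linarith)]
      have hCA : 0 ≤ C * A := by positivity
      calc _ ≤ C * (A * (((b : ℝ) - a) / k ^ 2)) +
            (C * A * (((mediant a b : ℝ) - a) / k) + C * A * (((b : ℝ) - mediant a b) / k)) :=
            add_le_add e3 (add_le_add (e1.trans (mul_le_mul_of_nonneg_left f1 hCA))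
              (e2.trans (mul_le_mul_of_nonneg_left f2 hCA)))
        _ = C * A * (((b : ℝ) - a) / k ^ 2 + ((b : ℝ) - a) / k) := by ring
        _ ≤ _ := mul_le_mul_of_nonneg_left f3 hCA
  refine summable_of_sum_le (c := C * A * (((b : ℝ) - a) / ((a.den : ℝ) + b.den - 1)))
    (fun r => hg r) fun u => ?_
  classical
  refine le_trans ?_ (key ((u.sup fun r => (r : ℚ).den) + 1) hab)
  refine (Finset.sum_map u (Function.Embedding.subtype _) g).symm.le.trans ?_
  refine Finset.sum_le_sum_of_subset_of_nonneg ?_ fun i _ _ => hg i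
  intro r hr
  obtain ⟨s, hs, rfl⟩ := Finset.mem_map.1 hr
  have : (s : ℚ).den ≤ u.sup fun r => (r : ℚ).den :=
    Finset.le_sup (f := fun r : Set.Ioo a b => (r : ℚ).den) hs
  exact mem_mediants (hP.pair hab) s.2.1 s.2.2
    (by simp only [Function.Embedding.subtype_apply]; omega)

/-- Telescoping over the Farey tree below an edge: a function `ρ` of Farey pairs whose increment at
each mediant is `g`, modulo a closed subgroup `L`, equals the sum of `g` modulo `L` as soon as it
decays geometrically in the denominators. After `n` generations, the error terms add
up to at most a constant times `(b - a) / (den a + den b + n)`, the lengths of the subintervals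
being additive. -/
theorem exists_hasSum_of_telescoping {P : ℚ → ℚ → Prop} (hP : FareyHereditary P)
    {g : ℚ → ℂ} {ρ : ℚ → ℚ → ℂ} {L : AddSubgroup ℂ} (hL : IsClosed (L : Set ℂ))
    (hρ : ∀ {a b}, P a b → ρ a b - (g (mediant a b) +
      (ρ a (mediant a b) + ρ (mediant a b) b)) ∈ L)
    {β C : ℝ} (h0 : 0 ≤ β) (h1 : β < 1) (hC : 0 ≤ C) (k₀ : ℕ)
    (hbound : ∀ {a b}, P a b → k₀ ≤ a.den + b.den → ‖ρ a b‖ ≤ C * β ^ (a.den + b.den))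
    {a b : ℚ} (hab : P a b) (hsum : Summable fun r : Set.Ioo a b => g r) :
    ∃ l ∈ L, HasSum (fun r : Set.Ioo a b => g r) (ρ a b + l) := by
  obtain ⟨A, hA0, hA⟩ := exists_pow_le_div β h0 h1 1
  have key : ∀ n : ℕ, ∀ {a b : ℚ}, P a b → k₀ ≤ n + a.den + b.den →
      ∃ l ∈ L, ‖∑ r ∈ mediants n a b, g r - ρ a b - l‖ ≤
        C * A * (((b : ℝ) - a) / ((a.den : ℝ) + b.den + n)) := by
    intro n
    induction n with
    | zero =>
      intro a b hab hk
      refine ⟨0, L.zero_mem, ?_⟩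
      have e := (hbound hab (by omega)).trans
        (mul_le_mul_of_nonneg_left (hA (hP.pair hab)) hC)
      simpa [mediants, mul_assoc] using e
    | succ n ih =>
      intro a b hab hk
      have hF := hP.pair hab
      have ha : (1 : ℝ) ≤ a.den := by exact_mod_cast a.den_pos
      have hb : (1 : ℝ) ≤ b.den := by exact_mod_cast b.den_pos
      have ha' := a.den_pos
      have hb' := b.den_pos
      have l1 : (a : ℝ) < mediant a b := by exact_mod_cast hF.left.lt
      have l2 : (mediant a b : ℝ) < b := by exact_mod_cast hF.right.lt
      obtain ⟨u, hu, e1⟩ := ih (hP.left hab) (by rw [hF.mediant_den]; omega)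
      obtain ⟨v, hv, e2⟩ := ih (hP.right hab) (by rw [hF.mediant_den]; omega)
      refine ⟨u + v - (ρ a b - (g (mediant a b) +
        (ρ a (mediant a b) + ρ (mediant a b) b))), L.sub_mem (L.add_mem hu hv) (hρ hab), ?_⟩
      rw [sum_mediants_succ g n hF]
      rw [hF.mediant_den] at e1 e2
      push_cast at e1 e2 ⊢
      have hn : (0 : ℝ) ≤ n := n.cast_nonneg
      set k : ℝ := (a.den : ℝ) + b.den with hk
      have hCA : 0 ≤ C * A := by positivity
      have f1 : ((mediant a b : ℝ) - a) / ((a.den : ℝ) + k + n) ≤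
          ((mediant a b : ℝ) - a) / (k + (n + 1)) :=
        div_le_div_of_nonneg_left (by linarith) (by linarith) (by linarith)
      have f2 : ((b : ℝ) - mediant a b) / (k + b.den + n) ≤
          ((b : ℝ) - mediant a b) / (k + (n + 1)) :=
        div_le_div_of_nonneg_left (by linarith) (by linarith) (by linarith)
      calc _ = ‖(∑ r ∈ mediants n a (mediant a b), g r - ρ a (mediant a b) - u) +
            (∑ r ∈ mediants n (mediant a b) b, g r - ρ (mediant a b) b - v)‖ := by
            congr 1; ring
        _ ≤ _ := norm_add_le _ _
        _ ≤ C * A * (((mediant a b : ℝ) - a) / (k + (n + 1))) +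
            C * A * (((b : ℝ) - mediant a b) / (k + (n + 1))) :=
            add_le_add (e1.trans (mul_le_mul_of_nonneg_left f1 hCA))
              (e2.trans (mul_le_mul_of_nonneg_left f2 hCA))
        _ = _ := by ring
  have hF := hP.pair hab
  obtain ⟨S, hS⟩ := hsum
  -- the sets `mediants n a b` exhaust the interval
  have hlim : Tendsto (fun n => ∑ r ∈ mediants n a b, g r) atTop (𝓝 S) := by
    classical
    have hT : Tendsto (fun n => (mediants n a b).subtype (· ∈ Set.Ioo a b)) atTop atTop := by
      refine tendsto_atTop_atTop.2 fun u => ⟨(u.sup fun r => (r : ℚ).den) + 1, fun n hn r hr => ?_⟩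
      have : (r : ℚ).den ≤ u.sup fun r => (r : ℚ).den :=
        Finset.le_sup (f := fun r : Set.Ioo a b => (r : ℚ).den) hr
      exact Finset.mem_subtype.2 (mem_mediants hF r.2.1 r.2.2 (by omega))
    refine (hS.comp hT).congr fun n => ?_
    exact Finset.sum_subtype_of_mem g fun r hr => mediants_subset hF r hr
  choose! l hl hle using fun n (hn : k₀ ≤ n + a.den + b.den) => key n hab hn
  have hzero : Tendsto (fun n : ℕ => C * A * (((b : ℝ) - a) / ((a.den : ℝ) + b.den + n)))
      atTop (𝓝 0) := by
    rw [← mul_zero (C * A)]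
    refine Tendsto.const_mul _ (Tendsto.div_atTop tendsto_const_nhds ?_)
    exact tendsto_atTop_add_const_left _ _ tendsto_natCast_atTop_atTop
  have hdiff : Tendsto (fun n => ∑ r ∈ mediants n a b, g r - ρ a b - l n) atTop (𝓝 0) := by
    refine squeeze_zero_norm' ?_ hzero
    filter_upwards [eventually_ge_atTop k₀] with n hn using hle n (by omega)
  have hlL : Tendsto l atTop (𝓝 (S - ρ a b)) := by
    have := (hlim.sub_const (ρ a b)).sub hdiff
    simpa using this
  refine ⟨S - ρ a b, ?_, by simpa using hS⟩
  refine hL.mem_of_tendsto hlL ?_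
  filter_upwards [eventually_ge_atTop k₀] with n hn using hl n (by omega)

/-! ### Estimates for the gap functions -/

theorem gapH_mul_one_sub {x : ℂ} (hx : x ≠ 0) : gapH x * (1 - gapH x) = 1 / x ^ 2 := by
  unfold gapH
  have := sqrt_sq (1 - 4 / x ^ 2)
  field_simp at this ⊢
  linear_combination -this

theorem gapH_re_le (x : ℂ) : (gapH x).re ≤ 1 / 2 := by
  have := sqrt_re_nonneg (1 - 4 / x ^ 2)
  unfold gapH
  rw [Complex.div_ofNat_re, Complex.sub_re, Complex.one_re]
  linarith

theorem half_le_norm_one_sub {s : ℂ} (hs : s.re ≤ 1 / 2) : 1 / 2 ≤ ‖1 - s‖ := by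
  refine le_trans ?_ (Complex.re_le_norm _)
  rw [Complex.sub_re, Complex.one_re]
  linarith

theorem norm_gapH_le {x : ℂ} (hx : x ≠ 0) : ‖gapH x‖ ≤ 2 / ‖x‖ ^ 2 := by
  have h1 := congrArg norm (gapH_mul_one_sub hx)
  rw [norm_mul, norm_div, norm_one, norm_pow] at h1
  have h2 := half_le_norm_one_sub (gapH_re_le x)
  have h3 : 2 / ‖x‖ ^ 2 = 2 * (1 / ‖x‖ ^ 2) := by ring
  rw [h3, ← h1]
  nlinarith [norm_nonneg (gapH x)]

theorem norm_gapH_le_half {x : ℂ} (hx : 2 ≤ ‖x‖) : ‖gapH x‖ ≤ 1 / 2 := by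
  refine (norm_gapH_le (norm_pos_iff.1 (by linarith))).trans ?_
  rw [div_le_div_iff₀ (by positivity) (by norm_num)]
  nlinarith

theorem le_re_one_sub_four_div {x : ℂ} {δ : ℝ} (hδ : 1 ≤ δ) (hx : 2 * δ ≤ ‖x‖) :
    1 - 1 / δ ^ 2 ≤ (1 - 4 / x ^ 2).re := by
  have h1 : (4 / x ^ 2).re ≤ 4 / ‖x‖ ^ 2 := by
    refine (Complex.re_le_norm _).trans ?_
    rw [norm_div, norm_pow]; norm_num
  have h2 : 4 / ‖x‖ ^ 2 ≤ 1 / δ ^ 2 := by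
    rw [div_le_div_iff₀ (by nlinarith) (by positivity)]
    nlinarith
  rw [Complex.sub_re, Complex.one_re]
  linarith

/-- Away from the disc of radius `2` the branch `h` stays away from the other root `1 - h` of the
equation `h (1 - h) = 1 / x²`. -/
theorem gapH_re_le_of_le {x : ℂ} {δ : ℝ} (hδ : 1 ≤ δ) (hx : 2 * δ ≤ ‖x‖) :
    (gapH x).re ≤ 1 / 2 - (1 - 1 / δ ^ 2) / 2 := by
  have h0 := sqrt_re_nonneg (1 - 4 / x ^ 2)
  have h1 := re_eq_sqrt (1 - 4 / x ^ 2)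
  have h2 := le_re_one_sub_four_div hδ hx
  have h3 : 0 < 1 / δ ^ 2 := by positivity
  have h4 : 1 - 1 / δ ^ 2 ≤ (Complex.sqrt (1 - 4 / x ^ 2)).re := by
    by_contra! hc
    nlinarith [sq_nonneg (Complex.sqrt (1 - 4 / x ^ 2)).im]
  unfold gapH
  rw [Complex.div_ofNat_re, Complex.sub_re, Complex.one_re]
  linarith

theorem continuousAt_gapH {x : ℂ} (hx : 2 < ‖x‖) : ContinuousAt gapH x := by
  have hx0 : x ≠ 0 := norm_pos_iff.1 (by linarith)
  have h1 : (1 - 4 / x ^ 2) ∈ Complex.slitPlane := by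
    left
    have := le_re_one_sub_four_div (x := x) (δ := ‖x‖ / 2) (by linarith) (by linarith)
    refine lt_of_lt_of_le ?_ this
    rw [sub_pos, div_lt_one (by positivity)]
    nlinarith
  have h2 : ContinuousAt (fun z : ℂ => 1 - 4 / z ^ 2) x :=
    continuousAt_const.sub (continuousAt_const.div (continuousAt_id.pow 2) (pow_ne_zero 2 hx0))
  unfold gapH Complex.sqrt
  exact (continuousAt_const.sub (h2.cpow continuousAt_const h1)).div_const 2

/-- The ratio `s = z / (x y)` and the sum `h x + h y` satisfy the same quadratic equation up to an
error of order `1 / (x y)²`. -/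
theorem norm_sub_gapH_add_mul_le {μ x y s : ℂ} (hx : 2 ≤ ‖x‖) (hy : 2 ≤ ‖y‖)
    (hs : s * (1 - s) = 1 / x ^ 2 + 1 / y ^ 2 - μ / (x ^ 2 * y ^ 2)) :
    ‖s - (gapH x + gapH y)‖ * ‖1 - s - (gapH x + gapH y)‖ ≤
      (‖μ‖ + 8) / (‖x‖ ^ 2 * ‖y‖ ^ 2) := by
  have hx0 : x ≠ 0 := norm_pos_iff.1 (by linarith)
  have hy0 : y ≠ 0 := norm_pos_iff.1 (by linarith)
  rw [← norm_mul]
  have e : (s - (gapH x + gapH y)) * (1 - s - (gapH x + gapH y)) =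
      -(μ / (x ^ 2 * y ^ 2)) + 2 * (gapH x * gapH y) := by
    linear_combination hs - gapH_mul_one_sub hx0 - gapH_mul_one_sub hy0
  rw [e]
  refine (norm_add_le _ _).trans ?_
  rw [norm_neg, norm_div, norm_mul, norm_mul, norm_mul, norm_pow, norm_pow, Complex.norm_ofNat]
  have := mul_le_mul (norm_gapH_le hx0) (norm_gapH_le hy0) (norm_nonneg _) (by positivity)
  have e2 : 2 / ‖x‖ ^ 2 * (2 / ‖y‖ ^ 2) = 4 / (‖x‖ ^ 2 * ‖y‖ ^ 2) := by
    rw [div_mul_div_comm]; norm_num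
  rw [e2] at this
  have e3 : (‖μ‖ + 8) / (‖x‖ ^ 2 * ‖y‖ ^ 2) =
      ‖μ‖ / (‖x‖ ^ 2 * ‖y‖ ^ 2) + 2 * (4 / (‖x‖ ^ 2 * ‖y‖ ^ 2)) := by ring
  rw [e3]
  linarith

/-- The ratio `s = z / (x y)`, being the root with real part at most `1 / 2`, is `h x + h y` up to an
error of order `1 / (x y)²`, provided `x y` is large. -/
theorem norm_sub_gapH_add_le {μ x y s : ℂ} {δ Δ : ℝ} (hδ : 1 ≤ δ)
    (hx : 2 * δ ≤ ‖x‖) (hy : 2 * δ ≤ ‖y‖) (hs' : s.re ≤ 1 / 2)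
    (hs : s * (1 - s) = 1 / x ^ 2 + 1 / y ^ 2 - μ / (x ^ 2 * y ^ 2))
    (hΔ : 4 * Δ ≤ ‖x‖ * ‖y‖) (hΔ' : 1 ≤ Δ * ((1 - 1 / δ ^ 2) / 2)) :
    ‖s - (gapH x + gapH y)‖ * ((1 - 1 / δ ^ 2) / 4) ≤ (‖μ‖ + 8) / (‖x‖ ^ 2 * ‖y‖ ^ 2) := by
  refine le_trans ?_ (norm_sub_gapH_add_mul_le (by linarith) (by linarith) hs)
  refine mul_le_mul_of_nonneg_left ?_ (norm_nonneg _)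
  set ε := 1 - 1 / δ ^ 2 with hε
  have hε0 : 0 ≤ ε := by
    rw [hε, sub_nonneg, div_le_one (by positivity)]; nlinarith
  have hΔ0 : 0 < Δ := by
    by_contra! h
    nlinarith [mul_nonneg (neg_nonneg.2 h) (by positivity : 0 ≤ ε / 2)]
  -- the larger of `x`, `y` contributes little to the real part
  have key : ∀ {u v : ℂ}, 2 * δ ≤ ‖u‖ → ‖u‖ ≤ ‖v‖ → 4 * Δ ≤ ‖u‖ * ‖v‖ →
      (gapH u).re + (gapH v).re ≤ 1 / 2 - ε / 4 := by
    intro u v hu huv h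
    have h1 := gapH_re_le_of_le hδ hu
    have hv : v ≠ 0 := norm_pos_iff.1 (by linarith)
    have h2 := (Complex.re_le_norm _).trans (norm_gapH_le hv)
    have h3 : 2 / ‖v‖ ^ 2 ≤ ε / 4 := by
      rw [div_le_iff₀ (by nlinarith)]
      have : 4 * Δ ≤ ‖v‖ ^ 2 := by nlinarith [norm_nonneg v]
      nlinarith [mul_le_mul_of_nonneg_left this hε0]
    linarith
  have h4 : (gapH x).re + (gapH y).re ≤ 1 / 2 - ε / 4 := by
    rcases le_total ‖x‖ ‖y‖ with h | h
    · exact key hx h hΔ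
    · rw [add_comm]; exact key hy h (by rwa [mul_comm ‖y‖])
  refine le_trans ?_ (Complex.re_le_norm _)
  simp only [Complex.sub_re, Complex.add_re, Complex.one_re]
  linarith

/-- `H_ω(x) = 1 + (ω - 1) h(x)`. For `ω = e^ν` the quotient `H_ω / H_{ω⁻¹}` is `exp ∘ 𝔥`. -/
noncomputable def gapFactor (ω x : ℂ) : ℂ := 1 + (ω - 1) * gapH x

theorem gapFactor_mul_inv {μ ω x : ℂ} (hω : ω ≠ 0) (hμ : ω + ω⁻¹ = 2 - μ) (hx : x ≠ 0) :
    gapFactor ω x * gapFactor ω⁻¹ x = 1 - μ / x ^ 2 := by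
  have h1 := gapH_mul_one_sub hx
  have h2 : ω * ω⁻¹ = 1 := mul_inv_cancel₀ hω
  unfold gapFactor
  linear_combination (gapH x - gapH x ^ 2) * hμ - μ * h1 + gapH x ^ 2 * h2

theorem norm_gapFactor_le {ω x : ℂ} (hx : 2 ≤ ‖x‖) : ‖gapFactor ω x‖ ≤ 1 + ‖ω - 1‖ := by
  unfold gapFactor
  refine (norm_add_le _ _).trans ?_
  rw [norm_one, norm_mul]
  have := norm_gapH_le_half hx
  nlinarith [norm_nonneg (ω - 1)]

theorem gapFactor_ne_zero {μ ω x : ℂ} (hω : ω ≠ 0) (hμ : ω + ω⁻¹ = 2 - μ) (hx : x ≠ 0)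
    (hxμ : x ^ 2 ≠ μ) : gapFactor ω x ≠ 0 := by
  intro h
  have := gapFactor_mul_inv hω hμ hx
  rw [h, zero_mul, eq_comm, sub_eq_zero, eq_comm, div_eq_one_iff_eq (pow_ne_zero 2 hx)] at this
  exact hxμ this.symm

/-- A lower bound for `|1 - μ / x²|` in terms of one for `|x² - μ|`, uniform in `x`. -/
theorem le_norm_one_sub_div {μ x : ℂ} {c : ℝ} (hc : 0 < c) (hx : x ≠ 0)
    (h : c ≤ ‖x ^ 2 - μ‖) : 1 / (1 + ‖μ‖ / c) ≤ ‖1 - μ / x ^ 2‖ := by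
  have hx2 : x ^ 2 ≠ 0 := pow_ne_zero 2 hx
  have e : 1 - μ / x ^ 2 = (x ^ 2 - μ) / x ^ 2 := by field_simp
  rw [e, norm_div, div_le_div_iff₀ (by positivity) (norm_pos_iff.2 hx2), one_mul]
  have h1 : ‖x ^ 2‖ ≤ ‖x ^ 2 - μ‖ + ‖μ‖ := by
    calc ‖x ^ 2‖ = ‖(x ^ 2 - μ) + μ‖ := by rw [sub_add_cancel]
      _ ≤ _ := norm_add_le _ _
  have h2 : ‖μ‖ ≤ ‖x ^ 2 - μ‖ * (‖μ‖ / c) := by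
    rw [mul_div_assoc', le_div_iff₀ hc, mul_comm]
    exact mul_le_mul_of_nonneg_right h (norm_nonneg _)
  linarith

theorem le_norm_gapFactor {μ ω x : ℂ} {c : ℝ} (hω : ω ≠ 0) (hμ : ω + ω⁻¹ = 2 - μ) (hc : 0 < c)
    (hx : 2 ≤ ‖x‖) (h : c ≤ ‖x ^ 2 - μ‖) :
    1 / (1 + ‖μ‖ / c) / (1 + ‖ω⁻¹ - 1‖) ≤ ‖gapFactor ω x‖ := by
  have hx0 : x ≠ 0 := norm_pos_iff.1 (by linarith)
  rw [div_le_iff₀ (by positivity)]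
  refine (le_norm_one_sub_div hc hx0 h).trans ?_
  rw [← gapFactor_mul_inv hω hμ hx0, norm_mul]
  exact mul_le_mul_of_nonneg_left (norm_gapFactor_le hx) (norm_nonneg _)

theorem norm_log_le {w : ℂ} (hw : ‖w - 1‖ ≤ 1 / 2) : ‖Complex.log w‖ ≤ 3 / 2 * ‖w - 1‖ := by
  have := Complex.norm_log_one_add_half_le_self hw
  rwa [add_sub_cancel] at this

/-! ### Growth of a Markoff map below an edge -/

theorem FareyPair.fareyNeighbor {a b : ℚ} (h : FareyPair a b) :
    FareyNeighbor (a : Region) (b : Region) := by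
  show |a.num * (b.den : ℤ) - b.num * (a.den : ℤ)| = 1
  unfold FareyPair at h
  rw [abs_sub_comm, h, abs_one]

theorem FareyPair.meetAtVertex {a b : ℚ} (h : FareyPair a b) :
    MeetAtVertex (a : Region) (b : Region) (mediant a b : Region) := by
  refine ⟨h.fareyNeighbor, ?_, h.left.fareyNeighbor⟩
  have := h.right.fareyNeighbor
  unfold FareyNeighbor at *
  rwa [abs_sub_comm]

theorem FareyNeighbor.symm {X Y : Region} (h : FareyNeighbor X Y) : FareyNeighbor Y X := by
  unfold FareyNeighbor at *
  rwa [abs_sub_comm]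

theorem fareyPair_int (n : ℤ) : FareyPair (n : ℚ) ((n + 1 : ℤ) : ℚ) := by
  unfold FareyPair
  simp only [Rat.num_intCast, Rat.den_intCast]
  push_cast
  ring

theorem fareyNeighbor_infty (n : ℤ) :
    FareyNeighbor (OnePoint.infty : Region) ((n : ℚ) : Region) := by
  show |(1 : ℤ) * (((n : ℚ).den : ℕ) : ℤ) - (n : ℚ).num * 0| = 1
  simp

namespace IsMarkoffMap

variable {μ : ℂ} {φ : Region → ℂ} (hφ : IsMarkoffMap μ φ) {a b : ℚ}
include hφ

theorem vertex_mediant (h : FareyPair a b) :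
    φ (a : Region) ^ 2 + φ (b : Region) ^ 2 + φ (mediant a b : Region) ^ 2 -
      φ (a : Region) * φ (b : Region) * φ (mediant a b : Region) = μ :=
  hφ.vertex _ _ _ h.meetAtVertex

theorem edge_left (h : FareyPair a b) : φ (a : Region) * φ (mediant a b : Region) =
    φ (b : Region) + φ (mediant a (mediant a b) : Region) := by
  refine hφ.edge _ _ _ _ ⟨⟨h.left.fareyNeighbor, h.right.fareyNeighbor, h.fareyNeighbor⟩,
    h.left.meetAtVertex, ?_⟩
  rw [Ne, OnePoint.coe_eq_coe]
  exact (h.left.right.lt.trans h.right.lt).ne'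

theorem edge_right (h : FareyPair a b) : φ (mediant a b : Region) * φ (b : Region) =
    φ (a : Region) + φ (mediant (mediant a b) b : Region) := by
  refine hφ.edge _ _ _ _ ⟨⟨h.right.fareyNeighbor, h.fareyNeighbor.symm,
    h.left.fareyNeighbor.symm⟩, h.right.meetAtVertex, ?_⟩
  rw [Ne, OnePoint.coe_eq_coe]
  exact (h.left.lt.trans h.right.left.lt).ne

theorem edge_int (n : ℤ) : φ ((n : ℚ) : Region) * φ (((n + 1 : ℤ) : ℚ) : Region) =
    φ OnePoint.infty + φ (mediant (n : ℚ) ((n + 1 : ℤ) : ℚ) : Region) := by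
  refine hφ.edge _ _ _ _ ⟨⟨(fareyPair_int n).fareyNeighbor, (fareyNeighbor_infty _).symm,
    (fareyNeighbor_infty _).symm⟩, (fareyPair_int n).meetAtVertex, ?_⟩
  exact OnePoint.infty_ne_coe _

theorem vertex_infty (n : ℤ) :
    φ OnePoint.infty ^ 2 + φ ((n : ℚ) : Region) ^ 2 + φ (((n + 1 : ℤ) : ℚ) : Region) ^ 2 -
      φ OnePoint.infty * φ ((n : ℚ) : Region) * φ (((n + 1 : ℤ) : ℚ) : Region) = μ :=
  hφ.vertex _ _ _ ⟨fareyNeighbor_infty _, (fareyPair_int n).fareyNeighbor,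
    fareyNeighbor_infty _⟩

theorem edge_infty (n : ℤ) : φ OnePoint.infty * φ (((n + 1 : ℤ) : ℚ) : Region) =
    φ ((n : ℚ) : Region) + φ (((n + 1 + 1 : ℤ) : ℚ) : Region) := by
  refine hφ.edge _ _ _ _ ⟨⟨fareyNeighbor_infty _, (fareyPair_int n).fareyNeighbor.symm,
    fareyNeighbor_infty _⟩, ⟨fareyNeighbor_infty _, (fareyPair_int (n + 1)).fareyNeighbor,
    fareyNeighbor_infty _⟩, ?_⟩
  rw [Ne, OnePoint.coe_eq_coe, Int.cast_inj]
  omega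

end IsMarkoffMap

/-- A Farey pair past which `φ` grows: the values at its ends are at least `2 δ ^ den`, and the value
`φ a * φ b - φ m` across the edge is at most the value at the mediant `m` in modulus. -/
structure GrowthPair (φ : Region → ℂ) (δ : ℝ) (a b : ℚ) : Prop where
  pair : FareyPair a b
  left_le : 2 * δ ^ a.den ≤ ‖φ (a : Region)‖
  right_le : 2 * δ ^ b.den ≤ ‖φ (b : Region)‖
  across_le : ‖φ (a : Region) * φ (b : Region) - φ (mediant a b : Region)‖ ≤
    ‖φ (mediant a b : Region)‖

theorem le_pow_den {δ : ℝ} (hδ : 1 < δ) (r : ℚ) : δ ≤ δ ^ r.den := by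
  simpa using pow_le_pow_right₀ hδ.le r.den_pos

namespace GrowthPair

variable {μ : ℂ} {φ : Region → ℂ} {δ : ℝ} {a b : ℚ}

theorem mul_le_two_mul_norm (h : GrowthPair φ δ a b) :
    ‖φ (a : Region)‖ * ‖φ (b : Region)‖ ≤ 2 * ‖φ (mediant a b : Region)‖ := by
  rw [← norm_mul]
  have h1 := norm_add_le (φ (a : Region) * φ (b : Region) - φ (mediant a b : Region))
    (φ (mediant a b : Region))
  rw [sub_add_cancel] at h1
  linarith [h.across_le]

/-- `|φ| / 2` is supermultiplicative under mediants, hence exponential in the denominator. -/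
theorem le_mediant (h : GrowthPair φ δ a b) (hδ : 1 < δ) :
    2 * δ ^ (mediant a b).den ≤ ‖φ (mediant a b : Region)‖ := by
  have h1 := mul_le_mul h.left_le h.right_le (by positivity) (norm_nonneg _)
  rw [h.pair.mediant_den, pow_add]
  nlinarith [h.mul_le_two_mul_norm]

theorem two_mul_le_left (h : GrowthPair φ δ a b) (hδ : 1 < δ) : 2 * δ ≤ ‖φ (a : Region)‖ := by
  linarith [h.left_le, le_pow_den hδ a]

theorem two_mul_le_right (h : GrowthPair φ δ a b) (hδ : 1 < δ) : 2 * δ ≤ ‖φ (b : Region)‖ := by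
  linarith [h.right_le, le_pow_den hδ b]

theorem two_mul_le_mediant (h : GrowthPair φ δ a b) (hδ : 1 < δ) :
    2 * δ ≤ ‖φ (mediant a b : Region)‖ := by
  linarith [h.le_mediant hδ, le_pow_den hδ (mediant a b)]

theorem left_le_mediant (h : GrowthPair φ δ a b) (hδ : 1 < δ) :
    ‖φ (a : Region)‖ ≤ ‖φ (mediant a b : Region)‖ := by
  nlinarith [h.mul_le_two_mul_norm, h.two_mul_le_right hδ, norm_nonneg (φ (a : Region))]

theorem right_le_mediant (h : GrowthPair φ δ a b) (hδ : 1 < δ) :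
    ‖φ (b : Region)‖ ≤ ‖φ (mediant a b : Region)‖ := by
  nlinarith [h.mul_le_two_mul_norm, h.two_mul_le_left hδ, norm_nonneg (φ (b : Region))]

theorem left (h : GrowthPair φ δ a b) (hφ : IsMarkoffMap μ φ) (hδ : 1 < δ) :
    GrowthPair φ δ a (mediant a b) := by
  refine ⟨h.pair.left, h.left_le, h.le_mediant hδ, ?_⟩
  have e := hφ.edge_left h.pair
  have e1 := congrArg norm e
  rw [norm_mul] at e1
  rw [e, add_sub_cancel_right]
  have := norm_add_le (φ (b : Region)) (φ (mediant a (mediant a b) : Region))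
  nlinarith [h.two_mul_le_left hδ, h.right_le_mediant hδ, norm_nonneg (φ (mediant a b : Region))]

theorem right (h : GrowthPair φ δ a b) (hφ : IsMarkoffMap μ φ) (hδ : 1 < δ) :
    GrowthPair φ δ (mediant a b) b := by
  refine ⟨h.pair.right, h.le_mediant hδ, h.right_le, ?_⟩
  have e := hφ.edge_right h.pair
  have e1 := congrArg norm e
  rw [norm_mul] at e1
  rw [e, add_sub_cancel_right]
  have := norm_add_le (φ (a : Region)) (φ (mediant (mediant a b) b : Region))
  nlinarith [h.two_mul_le_right hδ, h.left_le_mediant hδ, norm_nonneg (φ (mediant a b : Region))]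

/-- The values `x', y'` across the two edges that leave the vertex `(x, y, w)` satisfy
`x' y' = w (w² - μ) + x y`, while `|x'| ≥ |x w| / 2` and `|y'| ≥ |y w| / 2`. -/
theorem le_norm_sq_sub (h : GrowthPair φ δ a b) (hφ : IsMarkoffMap μ φ) (hδ : 1 < δ) :
    2 * (δ - 1) ≤ ‖φ (mediant a b : Region) ^ 2 - μ‖ := by
  have i1 := (h.left hφ hδ).mul_le_two_mul_norm
  have i2 := (h.right hφ hδ).mul_le_two_mul_norm
  have j1 := h.two_mul_le_left hδ
  have j2 := h.two_mul_le_right hδ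
  have j3 := h.two_mul_le_mediant hδ
  have e1 := hφ.edge_left h.pair
  have e2 := hφ.edge_right h.pair
  have e3 := hφ.vertex_mediant h.pair
  set x := φ (a : Region)
  set y := φ (b : Region)
  set w := φ (mediant a b : Region)
  set u := φ (mediant a (mediant a b) : Region)
  set v := φ (mediant (mediant a b) b : Region)
  have e : u * v = w * (w ^ 2 - μ) + x * y := by
    have hu : u = x * w - y := by linear_combination -e1
    have hv : v = w * y - x := by linear_combination -e2
    rw [hu, hv]
    linear_combination (-w) * e3
  have n1 : ‖u‖ * ‖v‖ ≤ ‖w‖ * ‖w ^ 2 - μ‖ + ‖x‖ * ‖y‖ := by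
    rw [← norm_mul, ← norm_mul, ← norm_mul, e]
    exact norm_add_le _ _
  have n2 : (‖x‖ * ‖w‖) * (‖w‖ * ‖y‖) ≤ 2 * ‖u‖ * (2 * ‖v‖) :=
    mul_le_mul i1 i2 (by positivity) (by positivity)
  have hxy : 4 ≤ ‖x‖ * ‖y‖ := by nlinarith
  have hw : δ * 2 ≤ ‖w‖ := by linarith
  have n3 : (‖x‖ * ‖y‖) * (‖w‖ ^ 2 / 4 - 1) ≤ ‖w‖ * ‖w ^ 2 - μ‖ := by nlinarith
  have n4 : 4 * (‖w‖ ^ 2 / 4 - 1) ≤ (‖x‖ * ‖y‖) * (‖w‖ ^ 2 / 4 - 1) :=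
    mul_le_mul_of_nonneg_right hxy (by nlinarith)
  have n5 : 2 * (δ - 1) * ‖w‖ ≤ 4 * (‖w‖ ^ 2 / 4 - 1) := by nlinarith
  have : ‖w‖ * (2 * (δ - 1)) ≤ ‖w‖ * ‖w ^ 2 - μ‖ := by linarith
  exact le_of_mul_le_mul_left this (by linarith)

end GrowthPair

theorem norm_le_norm_one_sub_iff {s : ℂ} : ‖s‖ ≤ ‖1 - s‖ ↔ s.re ≤ 1 / 2 := by
  rw [← sq_le_sq₀ (norm_nonneg _) (norm_nonneg _), ← Complex.normSq_eq_norm_sq,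
    ← Complex.normSq_eq_norm_sq, Complex.normSq_apply, Complex.normSq_apply]
  simp only [Complex.sub_re, Complex.sub_im, Complex.one_re, Complex.one_im]
  constructor <;> intro h <;> nlinarith

/-- The ratio `z / (x y)` at the edge between the regions `a` and `b`, where `z = x y - w` is the
value on the far side of the edge from the mediant. -/
noncomputable def edgeRatio (φ : Region → ℂ) (a b : ℚ) : ℂ :=
  1 - φ (mediant a b : Region) / (φ (a : Region) * φ (b : Region))

/-- The defect of `h x + h y` as an approximation to the edge ratio. -/
noncomputable def edgeDefect (φ : Region → ℂ) (a b : ℚ) : ℂ :=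
  edgeRatio φ a b - (gapH (φ (a : Region)) + gapH (φ (b : Region)))

/-- The edge weight `(1 + (ω - 1) z / (x y)) / (H_ω(x) H_ω(y))`. -/
noncomputable def edgeWeight (ω : ℂ) (φ : Region → ℂ) (a b : ℚ) : ℂ :=
  (1 + (ω - 1) * edgeRatio φ a b) /
    (gapFactor ω (φ (a : Region)) * gapFactor ω (φ (b : Region)))

theorem edgeRatio_left {μ : ℂ} {φ : Region → ℂ} {a b : ℚ} (hφ : IsMarkoffMap μ φ)
    (h : FareyPair a b) (ha : φ (a : Region) ≠ 0) (hm : φ (mediant a b : Region) ≠ 0) :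
    edgeRatio φ a (mediant a b) =
      φ (b : Region) / (φ (a : Region) * φ (mediant a b : Region)) := by
  unfold edgeRatio
  field_simp
  linear_combination hφ.edge_left h

theorem edgeRatio_right {μ : ℂ} {φ : Region → ℂ} {a b : ℚ} (hφ : IsMarkoffMap μ φ)
    (h : FareyPair a b) (hb : φ (b : Region) ≠ 0) (hm : φ (mediant a b : Region) ≠ 0) :
    edgeRatio φ (mediant a b) b =
      φ (a : Region) / (φ (mediant a b : Region) * φ (b : Region)) := by
  unfold edgeRatio
  field_simp
  linear_combination hφ.edge_right h

section Edge

variable {μ : ℂ} {φ : Region → ℂ} {a b : ℚ} (hφ : IsMarkoffMap μ φ) (h : FareyPair a b)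
  (ha : φ (a : Region) ≠ 0) (hb : φ (b : Region) ≠ 0) (hm : φ (mediant a b : Region) ≠ 0)
include hφ h ha hb

theorem edgeRatio_mul_one_sub :
    edgeRatio φ a b * (1 - edgeRatio φ a b) = 1 / φ (a : Region) ^ 2 + 1 / φ (b : Region) ^ 2 -
      μ / (φ (a : Region) ^ 2 * φ (b : Region) ^ 2) := by
  have e := hφ.vertex_mediant h
  unfold edgeRatio
  field_simp
  linear_combination -e

include hm

/-- The vertex relation for `μ = 0`, in terms of ratios. -/
theorem edgeRatio_eq_add (hμ : μ = 0) :
    edgeRatio φ a b = edgeRatio φ a (mediant a b) + edgeRatio φ (mediant a b) b := by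
  rw [edgeRatio_left hφ h ha hm, edgeRatio_right hφ h hb hm]
  have e := hφ.vertex_mediant h
  rw [hμ] at e
  unfold edgeRatio
  field_simp
  linear_combination -e

/-- The vertex relation for `μ ≠ 0`, in terms of ratios. -/
theorem one_add_mul_edgeRatio_mul {ω : ℂ} (hω : ω ≠ 0) (hμ : ω + ω⁻¹ = 2 - μ) :
    (1 + (ω - 1) * edgeRatio φ a b) * (1 - μ / φ (mediant a b : Region) ^ 2) =
      (1 + (ω - 1) * edgeRatio φ a (mediant a b)) *
        (1 + (ω - 1) * edgeRatio φ (mediant a b) b) := by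
  rw [edgeRatio_left hφ h ha hm, edgeRatio_right hφ h hb hm]
  have e := hφ.vertex_mediant h
  have e2 : (ω - 1) ^ 2 = -μ * ω := by field_simp at hμ; linear_combination hμ
  unfold edgeRatio
  set x := φ (a : Region)
  set y := φ (b : Region)
  set w := φ (mediant a b : Region)
  field_simp
  linear_combination (-(ω - 1) * w) * e + (-(x * y)) * e2

end Edge

/-- The edge relation: the factors on the two sides of an edge multiply to
`ω (1 - μ / x²) (1 - μ / y²)`. -/
theorem one_add_mul_edgeRatio_ne_zero {μ ω : ℂ} {φ : Region → ℂ} {a b : ℚ}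
    (hφ : IsMarkoffMap μ φ) (h : FareyPair a b) (hω : ω ≠ 0) (hμ : ω + ω⁻¹ = 2 - μ)
    (ha : φ (a : Region) ≠ 0) (hb : φ (b : Region) ≠ 0)
    (ha' : φ (a : Region) ^ 2 ≠ μ) (hb' : φ (b : Region) ^ 2 ≠ μ) :
    1 + (ω - 1) * edgeRatio φ a b ≠ 0 := by
  have e := edgeRatio_mul_one_sub hφ h ha hb
  have e2 : (ω - 1) ^ 2 = -μ * ω := by field_simp at hμ; linear_combination hμ
  have key : (1 + (ω - 1) * edgeRatio φ a b) * (1 + (ω - 1) * (1 - edgeRatio φ a b)) =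
      ω * (1 - μ / φ (a : Region) ^ 2) * (1 - μ / φ (b : Region) ^ 2) := by
    have : (1 + (ω - 1) * edgeRatio φ a b) * (1 + (ω - 1) * (1 - edgeRatio φ a b)) =
      ω + (ω - 1) ^ 2 * (edgeRatio φ a b * (1 - edgeRatio φ a b)) := by ring
    rw [this, e, e2]
    field_simp
    ring
  refine left_ne_zero_of_mul (b := 1 + (ω - 1) * (1 - edgeRatio φ a b)) ?_
  rw [key]
  have hD : ∀ {x : ℂ}, x ≠ 0 → x ^ 2 ≠ μ → 1 - μ / x ^ 2 ≠ 0 := by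
    intro x hx hxμ
    rw [Ne, sub_eq_zero, eq_comm, div_eq_one_iff_eq (pow_ne_zero 2 hx)]
    exact hxμ.symm
  exact mul_ne_zero (mul_ne_zero hω (hD ha ha')) (hD hb hb')

/-! ### Gap sums over a Farey interval -/

/-- A growth pair whose ends satisfy `|φ² - μ| ≥ c`. -/
structure TamePair (μ : ℂ) (φ : Region → ℂ) (δ c : ℝ) (a b : ℚ) : Prop
    extends GrowthPair φ δ a b where
  left_sq : c ≤ ‖φ (a : Region) ^ 2 - μ‖
  right_sq : c ≤ ‖φ (b : Region) ^ 2 - μ‖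

section Tame

variable {μ : ℂ} {φ : Region → ℂ} {δ c : ℝ}

theorem TamePair.hereditary (hφ : IsMarkoffMap μ φ) (hδ : 1 < δ) (hc : c ≤ 2 * (δ - 1)) :
    FareyHereditary (TamePair μ φ δ c) where
  pair h := h.pair
  left h := ⟨h.toGrowthPair.left hφ hδ, h.left_sq, hc.trans (h.toGrowthPair.le_norm_sq_sub hφ hδ)⟩
  right h :=
    ⟨h.toGrowthPair.right hφ hδ, hc.trans (h.toGrowthPair.le_norm_sq_sub hφ hδ), h.right_sq⟩

namespace GrowthPair

variable {a b : ℚ}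

theorem left_ne_zero (h : GrowthPair φ δ a b) (hδ : 1 < δ) : φ (a : Region) ≠ 0 :=
  norm_pos_iff.1 (by linarith [h.two_mul_le_left hδ])

theorem right_ne_zero (h : GrowthPair φ δ a b) (hδ : 1 < δ) : φ (b : Region) ≠ 0 :=
  norm_pos_iff.1 (by linarith [h.two_mul_le_right hδ])

theorem mediant_ne_zero (h : GrowthPair φ δ a b) (hδ : 1 < δ) :
    φ (mediant a b : Region) ≠ 0 :=
  norm_pos_iff.1 (by linarith [h.two_mul_le_mediant hδ])

theorem pow_le_mul (h : GrowthPair φ δ a b) (hδ : 1 < δ) :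
    4 * δ ^ (a.den + b.den) ≤ ‖φ (a : Region)‖ * ‖φ (b : Region)‖ := by
  have := mul_le_mul h.left_le h.right_le (by positivity) (norm_nonneg _)
  rw [pow_add]
  linarith

theorem one_div_le (h : GrowthPair φ δ a b) (hδ : 1 < δ) :
    1 / (‖φ (a : Region)‖ ^ 2 * ‖φ (b : Region)‖ ^ 2) ≤ ((1 / δ) ^ 2) ^ (a.den + b.den) := by
  have h1 := h.pow_le_mul hδ
  have h2 : (0 : ℝ) < δ ^ (a.den + b.den) := by positivity
  rw [← mul_pow, ← pow_mul, mul_comm 2, pow_mul, div_pow, one_pow, div_pow, one_pow]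
  refine one_div_le_one_div_of_le (by positivity) (pow_le_pow_left₀ h2.le (by linarith) 2)

theorem edgeRatio_re_le (h : GrowthPair φ δ a b) (hδ : 1 < δ) :
    (edgeRatio φ a b).re ≤ 1 / 2 := by
  rw [← norm_le_norm_one_sub_iff]
  have h0 : φ (a : Region) * φ (b : Region) ≠ 0 :=
    mul_ne_zero (h.left_ne_zero hδ) (h.right_ne_zero hδ)
  have e1 : edgeRatio φ a b = (φ (a : Region) * φ (b : Region) - φ (mediant a b : Region)) /
      (φ (a : Region) * φ (b : Region)) := by
    unfold edgeRatio
    rw [sub_div, div_self h0]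
  have e2 : 1 - edgeRatio φ a b = φ (mediant a b : Region) /
      (φ (a : Region) * φ (b : Region)) := by
    unfold edgeRatio
    rw [sub_sub_cancel]
  rw [e2, e1, norm_div, norm_div]
  exact div_le_div_of_nonneg_right h.across_le (norm_nonneg _)

theorem norm_gapH_mediant_le (h : GrowthPair φ δ a b) (hδ : 1 < δ) :
    ‖gapH (φ (mediant a b : Region))‖ ≤ 8 * ((1 / δ) ^ 2) ^ (a.den + b.den) := by
  have h1 := h.mul_le_two_mul_norm
  have h2 := h.one_div_le hδ
  have h3 : 0 < ‖φ (a : Region)‖ := norm_pos_iff.2 (h.left_ne_zero hδ)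
  have h4 : 0 < ‖φ (b : Region)‖ := norm_pos_iff.2 (h.right_ne_zero hδ)
  have h5 : 0 < ‖φ (mediant a b : Region)‖ := norm_pos_iff.2 (h.mediant_ne_zero hδ)
  refine (norm_gapH_le (h.mediant_ne_zero hδ)).trans (le_trans ?_
    (mul_le_mul_of_nonneg_left h2 (by norm_num)))
  rw [mul_one_div, div_le_div_iff₀ (by positivity) (by positivity), ← mul_pow]
  nlinarith [mul_pos h3 h4]

end GrowthPair

theorem exists_edgeDefect_le (hφ : IsMarkoffMap μ φ) (hδ : 1 < δ) :
    ∃ C : ℝ, 0 ≤ C ∧ ∃ k₀ : ℕ, ∀ {a b : ℚ}, GrowthPair φ δ a b → k₀ ≤ a.den + b.den →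
      ‖edgeDefect φ a b‖ ≤ C * ((1 / δ) ^ 2) ^ (a.den + b.den) := by
  have hε : 0 < 1 - 1 / δ ^ 2 := by
    rw [sub_pos, div_lt_one (by positivity)]; nlinarith
  obtain ⟨k₀, hk₀⟩ := pow_unbounded_of_one_lt (1 / ((1 - 1 / δ ^ 2) / 2)) hδ
  refine ⟨(‖μ‖ + 8) / ((1 - 1 / δ ^ 2) / 4), by positivity, k₀, fun {a b} h hk => ?_⟩
  have h1 := norm_sub_gapH_add_le (μ := μ) hδ.le (h.two_mul_le_left hδ) (h.two_mul_le_right hδ)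
    (h.edgeRatio_re_le hδ)
    (edgeRatio_mul_one_sub hφ h.pair (h.left_ne_zero hδ) (h.right_ne_zero hδ))
    (h.pow_le_mul hδ) (by
      rw [← div_le_iff₀ (by positivity)]
      exact hk₀.le.trans (pow_le_pow_right₀ hδ.le hk))
  unfold edgeDefect
  rw [div_mul_eq_mul_div, le_div_iff₀ (by positivity)]
  refine h1.trans ?_
  rw [← mul_one_div]
  exact mul_le_mul_of_nonneg_left (h.one_div_le hδ) (by positivity)

theorem exists_edgeWeight_le (hφ : IsMarkoffMap μ φ) (hδ : 1 < δ) (hc : 0 < c) {ω : ℂ}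
    (hω : ω ≠ 0) (hμ : ω + ω⁻¹ = 2 - μ) :
    ∃ C : ℝ, 0 ≤ C ∧ ∃ k₀ : ℕ, ∀ {a b : ℚ}, TamePair μ φ δ c a b → k₀ ≤ a.den + b.den →
      ‖edgeWeight ω φ a b - 1‖ ≤ C * ((1 / δ) ^ 2) ^ (a.den + b.den) := by
  obtain ⟨C, hC, k₀, h⟩ := exists_edgeDefect_le hφ hδ
  set m : ℝ := 1 / (1 + ‖μ‖ / c) / (1 + ‖ω⁻¹ - 1‖) with hm
  have hm0 : 0 < m := by positivity
  refine ⟨(‖ω - 1‖ * C + ‖ω - 1‖ ^ 2 * 4) / m ^ 2, by positivity, k₀, fun {a b} ht hk => ?_⟩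
  have ha := ht.left_ne_zero hδ
  have hb := ht.right_ne_zero hδ
  have ha2 : 2 ≤ ‖φ (a : Region)‖ := by linarith [ht.two_mul_le_left hδ]
  have hb2 : 2 ≤ ‖φ (b : Region)‖ := by linarith [ht.two_mul_le_right hδ]
  have ma := le_norm_gapFactor hω hμ hc ha2 ht.left_sq
  have mb := le_norm_gapFactor hω hμ hc hb2 ht.right_sq
  rw [← hm] at ma mb
  have na : gapFactor ω (φ (a : Region)) ≠ 0 := norm_pos_iff.1 (by linarith)
  have nb : gapFactor ω (φ (b : Region)) ≠ 0 := norm_pos_iff.1 (by linarith)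
  have e : edgeWeight ω φ a b - 1 = ((ω - 1) * edgeDefect φ a b -
      (ω - 1) ^ 2 * (gapH (φ (a : Region)) * gapH (φ (b : Region)))) /
      (gapFactor ω (φ (a : Region)) * gapFactor ω (φ (b : Region))) := by
    unfold edgeWeight
    rw [div_sub_one (mul_ne_zero na nb)]
    congr 1
    unfold edgeDefect gapFactor
    ring
  have d1 := h ht.toGrowthPair hk
  have d2 : ‖gapH (φ (a : Region)) * gapH (φ (b : Region))‖ ≤
      4 * ((1 / δ) ^ 2) ^ (a.den + b.den) := by
    refine le_trans ?_ (mul_le_mul_of_nonneg_left (ht.one_div_le hδ) (by norm_num))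
    rw [norm_mul]
    refine (mul_le_mul (norm_gapH_le ha) (norm_gapH_le hb) (norm_nonneg _)
      (by positivity)).trans_eq ?_
    rw [div_mul_div_comm]; norm_num; ring
  rw [e, norm_div, norm_mul (gapFactor _ _), div_mul_eq_mul_div]
  refine div_le_div₀ (by positivity) ?_ (by positivity) ?_
  · refine (norm_sub_le _ _).trans ?_
    rw [norm_mul, norm_mul, norm_pow, add_mul]
    refine add_le_add ?_ ?_
    · rw [mul_assoc]; exact mul_le_mul_of_nonneg_left d1 (norm_nonneg _)
    · rw [mul_assoc]; exact mul_le_mul_of_nonneg_left d2 (by positivity)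
  · rw [sq]; exact mul_le_mul ma mb hm0.le (norm_nonneg _)

theorem inv_sq_lt_one (hδ : 1 < δ) : (1 / δ) ^ 2 < 1 := by
  rw [div_pow, one_pow, div_lt_one (by positivity)]
  nlinarith

theorem summable_gapH (hφ : IsMarkoffMap μ φ) (hδ : 1 < δ) (hc : c ≤ 2 * (δ - 1)) {a b : ℚ}
    (h : TamePair μ φ δ c a b) :
    Summable fun r : Set.Ioo a b => ‖gapH (φ ((r : ℚ) : Region))‖ :=
  summable_of_mediant_le (TamePair.hereditary hφ hδ hc)
    (g := fun r => ‖gapH (φ (r : Region))‖) (fun _ => norm_nonneg _) (by positivity)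
    (inv_sq_lt_one hδ) (by norm_num) (fun h => h.norm_gapH_mediant_le hδ) h

/-- The gap sum over a Farey interval for `μ = 0`. -/
theorem hasSum_two_mul_gapH (hφ : IsMarkoffMap μ φ) (hμ : μ = 0) (hδ : 1 < δ)
    (hc : c ≤ 2 * (δ - 1)) {a b : ℚ} (h : TamePair μ φ δ c a b) :
    HasSum (fun r : Set.Ioo a b => 2 * gapH (φ ((r : ℚ) : Region))) (edgeDefect φ a b) := by
  obtain ⟨C, hC, k₀, hk⟩ := exists_edgeDefect_le hφ hδ
  obtain ⟨l, hl, hs⟩ := exists_hasSum_of_telescoping (TamePair.hereditary hφ hδ hc)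
    (g := fun r => 2 * gapH (φ (r : Region))) (ρ := edgeDefect φ) (L := ⊥)
    (by simp)
    (by
      intro a b h
      rw [AddSubgroup.mem_bot]
      have := edgeRatio_eq_add hφ h.pair (h.left_ne_zero hδ) (h.right_ne_zero hδ)
        (h.mediant_ne_zero hδ) hμ
      unfold edgeDefect
      linear_combination this)
    (by positivity) (inv_sq_lt_one hδ) hC k₀ (fun h => hk h.toGrowthPair) h
    ((summable_gapH hφ hδ hc h).of_norm.mul_left 2)
  rw [AddSubgroup.mem_bot] at hl
  simpa [hl] using hs

/-- The periods of the exponential. -/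
def expPeriods : AddSubgroup ℂ where
  carrier := {z | Complex.exp z = 1}
  zero_mem' := Complex.exp_zero
  add_mem' {z w} hz hw := by
    simp only [Set.mem_ofPred_eq] at *
    rw [Complex.exp_add, hz, hw, one_mul]
  neg_mem' {z} hz := by
    simp only [Set.mem_ofPred_eq] at *
    rw [Complex.exp_neg, hz, inv_one]

theorem mem_expPeriods {z : ℂ} : z ∈ expPeriods ↔ Complex.exp z = 1 := Iff.rfl

theorem isClosed_expPeriods : IsClosed (expPeriods : Set ℂ) :=
  isClosed_eq Complex.continuous_exp continuous_const

theorem TamePair.edgeWeight_eq_mul (hφ : IsMarkoffMap μ φ) (hδ : 1 < δ) (hc0 : 0 < c)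
    (hc : c ≤ 2 * (δ - 1)) {ω : ℂ} (hω : ω ≠ 0) (hμ : ω + ω⁻¹ = 2 - μ) {a b : ℚ}
    (h : TamePair μ φ δ c a b) :
    edgeWeight ω φ a b = gapFactor ω (φ (mediant a b : Region)) /
      gapFactor ω⁻¹ (φ (mediant a b : Region)) *
        (edgeWeight ω φ a (mediant a b) * edgeWeight ω φ (mediant a b) b) ∧
    edgeWeight ω φ a b ≠ 0 := by
  have hne : ∀ {x : ℂ}, c ≤ ‖x ^ 2 - μ‖ → x ^ 2 ≠ μ := by
    intro x hx he
    rw [he, sub_self, norm_zero] at hx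
    linarith
  have ha := h.left_ne_zero hδ
  have hb := h.right_ne_zero hδ
  have hm := h.mediant_ne_zero hδ
  have hμ' : ω⁻¹ + ω⁻¹⁻¹ = 2 - μ := by rw [inv_inv, add_comm, hμ]
  have hm2 := hne (hc.trans (h.toGrowthPair.le_norm_sq_sub hφ hδ))
  have fa := gapFactor_ne_zero hω hμ ha (hne h.left_sq)
  have fb := gapFactor_ne_zero hω hμ hb (hne h.right_sq)
  have fm := gapFactor_ne_zero hω hμ hm hm2
  have fm' := gapFactor_ne_zero (inv_ne_zero hω) hμ' hm hm2
  refine ⟨?_, div_ne_zero (one_add_mul_edgeRatio_ne_zero hφ h.pair hω hμ ha hb (hne h.left_sq)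
    (hne h.right_sq)) (mul_ne_zero fa fb)⟩
  have e := one_add_mul_edgeRatio_mul hφ h.pair ha hb hm hω hμ
  rw [← gapFactor_mul_inv hω hμ hm] at e
  unfold edgeWeight
  rw [div_mul_div_comm, div_mul_div_comm, ← e]
  generalize gapFactor ω⁻¹ (φ (mediant a b : Region)) = F at fm' ⊢
  field_simp

/-- The gap sum over a Farey interval for `μ ≠ 0`, modulo the periods of the exponential. -/
theorem exists_hasSum_exp_eq_edgeWeight (hφ : IsMarkoffMap μ φ) (hδ : 1 < δ) (hc0 : 0 < c)
    (hc : c ≤ 2 * (δ - 1)) {ω : ℂ} (hω : ω ≠ 0) (hμ : ω + ω⁻¹ = 2 - μ) {g : ℚ → ℂ}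
    (hg : ∀ r : ℚ, Complex.exp (g r) =
      gapFactor ω (φ (r : Region)) / gapFactor ω⁻¹ (φ (r : Region)))
    {a b : ℚ} (h : TamePair μ φ δ c a b) (hs : Summable fun r : Set.Ioo a b => g r) :
    ∃ S, HasSum (fun r : Set.Ioo a b => g r) S ∧ Complex.exp S = edgeWeight ω φ a b := by
  have hP := TamePair.hereditary hφ hδ hc
  obtain ⟨C, hC, k₀, hk⟩ := exists_edgeWeight_le hφ hδ hc0 hω hμ
  have hβ : Tendsto (fun k : ℕ => C * ((1 / δ) ^ 2) ^ k) atTop (𝓝 0) := by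
    rw [← mul_zero C]
    exact (tendsto_pow_atTop_nhds_zero_of_lt_one (by positivity) (inv_sq_lt_one hδ)).const_mul C
  obtain ⟨k₁, hk₁⟩ := eventually_atTop.1 (hβ.eventually_le_const (by norm_num : (0 : ℝ) < 1 / 2))
  have hW := fun {a b : ℚ} (h : TamePair μ φ δ c a b) =>
    TamePair.edgeWeight_eq_mul hφ hδ hc0 hc hω hμ h
  obtain ⟨l, hl, hS⟩ := exists_hasSum_of_telescoping hP (g := g)
    (ρ := fun a b => Complex.log (edgeWeight ω φ a b)) isClosed_expPeriods
    (by
      intro a b h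
      have h1 := (hW h).1
      have h2 := (hW h).2
      rw [mem_expPeriods, Complex.exp_sub, Complex.exp_add, Complex.exp_add, hg,
        Complex.exp_log h2, Complex.exp_log (hW (hP.left h)).2,
        Complex.exp_log (hW (hP.right h)).2, ← h1, div_self h2])
    (by positivity) (inv_sq_lt_one hδ) (C := 3 / 2 * C) (by positivity) (max k₀ k₁)
    (by
      intro a b h hab
      have h1 := hk h ((le_max_left _ _).trans hab)
      have h2 := hk₁ _ ((le_max_right _ _).trans hab)
      refine (norm_log_le (h1.trans h2)).trans ?_
      rw [mul_assoc]
      exact mul_le_mul_of_nonneg_left h1 (by norm_num))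
    h hs
  refine ⟨_, hS, ?_⟩
  rw [mem_expPeriods] at hl
  rw [Complex.exp_add, hl, mul_one, Complex.exp_log (hW h).2]

theorem summable_log_gapFactor (hφ : IsMarkoffMap μ φ) (hδ : 1 < δ) (hc0 : 0 < c)
    (hc : c ≤ 2 * (δ - 1)) {ω : ℂ} (hω : ω ≠ 0) (hμ : ω + ω⁻¹ = 2 - μ) {a b : ℚ}
    (h : TamePair μ φ δ c a b) :
    Summable fun r : Set.Ioo a b => Complex.log (gapFactor ω (φ ((r : ℚ) : Region)) /
      gapFactor ω⁻¹ (φ ((r : ℚ) : Region))) := by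
  have hP := TamePair.hereditary hφ hδ hc
  have hμ' : ω⁻¹ + ω⁻¹⁻¹ = 2 - μ := by rw [inv_inv, add_comm, hμ]
  set m : ℝ := 1 / (1 + ‖μ‖ / c) / (1 + ‖ω⁻¹⁻¹ - 1‖) with hm
  have hm0 : 0 < m := by positivity
  have key : Summable fun r : Set.Ioo a b => gapFactor ω (φ ((r : ℚ) : Region)) /
      gapFactor ω⁻¹ (φ ((r : ℚ) : Region)) - 1 := by
    refine Summable.of_norm_bounded (((summable_gapH hφ hδ hc h).mul_left (‖ω - ω⁻¹‖ / m))) ?_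
    rintro ⟨r, hr⟩
    obtain ⟨a', b', h', rfl⟩ := hP.exists_eq_mediant h hr.1 hr.2
    have h2 : 2 ≤ ‖φ (mediant a' b' : Region)‖ := by linarith [h'.two_mul_le_mediant hδ]
    have h3 := le_norm_gapFactor (inv_ne_zero hω) hμ' hc0 h2
      (hc.trans (h'.toGrowthPair.le_norm_sq_sub hφ hδ))
    rw [← hm] at h3
    have h4 : gapFactor ω⁻¹ (φ (mediant a' b' : Region)) ≠ 0 := norm_pos_iff.1 (by linarith)
    have e : gapFactor ω (φ (mediant a' b' : Region)) - gapFactor ω⁻¹ (φ (mediant a' b' : Region))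
        = (ω - ω⁻¹) * gapH (φ (mediant a' b' : Region)) := by
      unfold gapFactor; ring
    rw [div_sub_one h4, e, norm_div, norm_mul, div_mul_eq_mul_div]
    exact div_le_div_of_nonneg_left (by positivity) hm0 h3
  refine (Complex.summable_log_one_add_of_summable key).congr fun r => ?_
  rw [add_sub_cancel]

end Tame

/-! ### Recurrence of rotations -/

section Rotation

variable {θ : ℝ} {u : ℕ → ℂ}

theorem sin_add_two_mul (n : ℕ) (θ : ℝ) : Real.sin (((n + 2 : ℕ) : ℝ) * θ) =
    2 * Real.cos θ * Real.sin (((n + 1 : ℕ) : ℝ) * θ) - Real.sin ((n : ℝ) * θ) := by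
  have e1 : ((n + 2 : ℕ) : ℝ) * θ = ((n + 1 : ℕ) : ℝ) * θ + θ := by push_cast; ring
  have e2 : (n : ℝ) * θ = ((n + 1 : ℕ) : ℝ) * θ - θ := by push_cast; ring
  rw [e1, e2, Real.sin_add, Real.sin_sub]
  ring

theorem cos_add_two_mul (n : ℕ) (θ : ℝ) : Real.cos (((n + 2 : ℕ) : ℝ) * θ) =
    2 * Real.cos θ * Real.cos (((n + 1 : ℕ) : ℝ) * θ) - Real.cos ((n : ℝ) * θ) := by
  have e1 : ((n + 2 : ℕ) : ℝ) * θ = ((n + 1 : ℕ) : ℝ) * θ + θ := by push_cast; ring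
  have e2 : (n : ℝ) * θ = ((n + 1 : ℕ) : ℝ) * θ - θ := by push_cast; ring
  rw [e1, e2, Real.cos_add, Real.cos_sub]
  ring

/-- The solution of `u (n + 2) = 2 cos θ u (n + 1) - u n` in terms of its initial values. -/
theorem mul_sin_eq_of_recurrence
    (hu : ∀ n, u (n + 2) = ((2 * Real.cos θ : ℝ) : ℂ) * u (n + 1) - u n) (n : ℕ) :
    u n * (Real.sin θ : ℂ) = u 0 * ((Real.cos ((n : ℝ) * θ) * Real.sin θ -
      Real.sin ((n : ℝ) * θ) * Real.cos θ : ℝ) : ℂ) + u 1 * (Real.sin ((n : ℝ) * θ) : ℂ) := by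
  induction n using Nat.twoStepInduction with
  | zero => simp
  | one => simp [mul_comm]
  | more n ih1 ih2 =>
    rw [hu, sin_add_two_mul, cos_add_two_mul]
    push_cast at ih1 ih2 ⊢
    linear_combination (2 * Complex.cos θ) * ih2 - ih1

/-- The initial value of such a solution in terms of two later consecutive values. -/
theorem zero_mul_sin_eq_of_recurrence
    (hu : ∀ n, u (n + 2) = ((2 * Real.cos θ : ℝ) : ℂ) * u (n + 1) - u n) (n : ℕ) :
    u 0 * (Real.sin θ : ℂ) = u n * (Real.sin (((n + 1 : ℕ) : ℝ) * θ) : ℂ) -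
      u (n + 1) * (Real.sin ((n : ℝ) * θ) : ℂ) := by
  induction n with
  | zero => simp
  | succ n ih =>
    rw [ih, hu, sin_add_two_mul]
    push_cast
    ring

theorem norm_ofReal_le_one {x : ℝ} (hx : |x| ≤ 1) : ‖(x : ℂ)‖ ≤ 1 := by
  rwa [Complex.norm_real, Real.norm_eq_abs]

theorem exists_norm_le_of_recurrence (hθ : 0 < Real.sin θ)
    (hu : ∀ n, u (n + 2) = ((2 * Real.cos θ : ℝ) : ℂ) * u (n + 1) - u n) :
    ∃ M : ℝ, 0 < M ∧ ∀ n, ‖u n‖ ≤ M := by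
  refine ⟨(‖u 0‖ + ‖u 1‖ + 1) / Real.sin θ, by positivity, fun n => ?_⟩
  rw [le_div_iff₀ hθ]
  have e := congrArg norm (mul_sin_eq_of_recurrence hu n)
  rw [norm_mul, Complex.norm_real, Real.norm_eq_abs, abs_of_pos hθ] at e
  rw [e]
  refine (norm_add_le _ _).trans ?_
  rw [norm_mul, norm_mul]
  have h1 := norm_ofReal_le_one (Real.abs_sin_le_one ((n : ℝ) * θ))
  have h2 : ‖((Real.cos ((n : ℝ) * θ) * Real.sin θ -
      Real.sin ((n : ℝ) * θ) * Real.cos θ : ℝ) : ℂ)‖ ≤ 1 := by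
    rw [mul_comm (Real.cos _), mul_comm (Real.sin ((n : ℝ) * θ)), ← Real.sin_sub]
    exact norm_ofReal_le_one (Real.abs_sin_le_one _)
  nlinarith [norm_nonneg (u 0), norm_nonneg (u 1)]

theorem norm_zero_mul_sin_le (hθ : 0 < Real.sin θ)
    (hu : ∀ n, u (n + 2) = ((2 * Real.cos θ : ℝ) : ℂ) * u (n + 1) - u n) (n : ℕ) :
    ‖u 0‖ * Real.sin θ ≤ ‖u n‖ + ‖u (n + 1)‖ := by
  have e := congrArg norm (zero_mul_sin_eq_of_recurrence hu n)
  rw [norm_mul, Complex.norm_real, Real.norm_eq_abs, abs_of_pos hθ] at e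
  rw [e]
  refine (norm_sub_le _ _).trans ?_
  rw [norm_mul, norm_mul]
  exact add_le_add
    (mul_le_of_le_one_right (norm_nonneg _) (norm_ofReal_le_one (Real.abs_sin_le_one _)))
    (mul_le_of_le_one_right (norm_nonneg _) (norm_ofReal_le_one (Real.abs_sin_le_one _)))

/-- Recurrence of the rotation by `θ`, from compactness of the circle. -/
theorem exists_strictMono_tendsto_cos_sin (θ : ℝ) : ∃ n : ℕ → ℕ, StrictMono n ∧ (∀ k, 0 < n k) ∧
    Tendsto (fun k => Real.cos ((n k : ℝ) * θ)) atTop (𝓝 1) ∧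
    Tendsto (fun k => Real.sin ((n k : ℝ) * θ)) atTop (𝓝 0) := by
  have h := mapClusterPt_one_atTop_pow (Circle.exp θ)
  obtain ⟨n, hn, hlim⟩ := MapClusterPt.tendsto_subseq h
  have hlim' : Tendsto (fun k => Complex.exp (((n (k + 1) : ℝ) * θ : ℝ) * Complex.I)) atTop
      (𝓝 1) := by
    have hcoe : Continuous fun z : Circle => (z : ℂ) := continuous_subtype_val
    have h1 : Tendsto (fun k => ((Circle.exp θ ^ n (k + 1) : Circle) : ℂ)) atTop
        (𝓝 ((1 : Circle) : ℂ)) :=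
      (hcoe.tendsto 1).comp (hlim.comp (tendsto_add_atTop_nat 1))
    rw [Circle.coe_one] at h1
    refine h1.congr fun k => ?_
    simp only [Circle.coe_pow, Circle.coe_exp]
    rw [← Complex.exp_nat_mul]
    congr 1
    push_cast
    ring
  refine ⟨fun k => n (k + 1), hn.comp (strictMono_nat_of_lt_succ fun k => k.succ.lt_succ_self),
    fun k => (Nat.zero_le _).trans_lt (hn k.succ_pos), ?_, ?_⟩
  · have := (Complex.continuous_re.tendsto 1).comp hlim'
    refine (this.congr fun k => ?_)
    simp only [Function.comp_apply, Complex.exp_ofReal_mul_I_re]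
  · have := (Complex.continuous_im.tendsto 1).comp hlim'
    refine (this.congr fun k => ?_)
    simp only [Function.comp_apply, Complex.exp_ofReal_mul_I_im]

theorem tendsto_zero_of_recurrence (hθ : 0 < Real.sin θ)
    (hu : ∀ n, u (n + 2) = ((2 * Real.cos θ : ℝ) : ℂ) * u (n + 1) - u n) {n : ℕ → ℕ}
    (hc : Tendsto (fun k => Real.cos ((n k : ℝ) * θ)) atTop (𝓝 1))
    (hs : Tendsto (fun k => Real.sin ((n k : ℝ) * θ)) atTop (𝓝 0)) :
    Tendsto (fun k => u (n k)) atTop (𝓝 (u 0)) := by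
  have h0 : (Real.sin θ : ℂ) ≠ 0 := by exact_mod_cast hθ.ne'
  have h1 : Tendsto (fun k => ((Real.cos ((n k : ℝ) * θ) * Real.sin θ -
      Real.sin ((n k : ℝ) * θ) * Real.cos θ : ℝ) : ℂ)) atTop
      (𝓝 ((1 * Real.sin θ - 0 * Real.cos θ : ℝ) : ℂ)) :=
    (Complex.continuous_ofReal.tendsto _).comp
      ((hc.mul_const (Real.sin θ)).sub (hs.mul_const (Real.cos θ)))
  have h2 : Tendsto (fun k => (Real.sin ((n k : ℝ) * θ) : ℂ)) atTop (𝓝 ((0 : ℝ) : ℂ)) :=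
    (Complex.continuous_ofReal.tendsto _).comp hs
  have h3 := (((h1.const_mul (u 0)).add (h2.const_mul (u 1))).div_const (Real.sin θ : ℂ))
  rw [one_mul, zero_mul, sub_zero, Complex.ofReal_zero, mul_zero, add_zero,
    mul_div_cancel_right₀ _ h0] at h3
  refine h3.congr fun k => ?_
  rw [← mul_sin_eq_of_recurrence hu, mul_div_cancel_right₀ _ h0]

end Rotation

/-! ### The neighbors of infinity -/

theorem hasSum_ratIoc {g : ℚ → ℂ} {T : ℕ → ℂ}
    (h : ∀ n : ℕ, HasSum (fun r : Set.Ioo (((n : ℤ)) : ℚ) (((n : ℤ) + 1 : ℤ) : ℚ) => g r) (T n))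
    (N : ℕ) : HasSum (fun r : ratIoc N => g r)
      (∑ n ∈ Finset.range N, (T n + g (((n : ℤ) + 1 : ℤ) : ℚ))) := by
  induction N with
  | zero =>
    have : IsEmpty (ratIoc 0) := by
      refine ⟨fun r => ?_⟩
      have h1 := r.2.1
      have h2 := r.2.2
      rw [Nat.cast_zero] at h2
      exact absurd h1 (not_lt.2 h2)
    simp
  | succ N ih =>
    rw [Finset.sum_range_succ, ← add_assoc]
    set b : ℚ := (((N : ℤ) + 1 : ℤ) : ℚ) with hb
    have hb' : b = (N : ℚ) + 1 := by rw [hb]; push_cast; ring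
    have hN : ((N : ℤ) : ℚ) = (N : ℚ) := by push_cast; ring
    have h1 : HasSum (g ∘ ((↑) : ({b} : Set ℚ) → ℚ)) (g b) := hasSum_unique _
    have d1 : Disjoint (ratIoc N) (Set.Ioo ((N : ℤ) : ℚ) b) := by
      rw [Set.disjoint_left]
      intro r hr hr'
      rw [hN] at hr'
      exact absurd hr'.1 (not_lt.2 hr.2)
    have h2 := HasSum.add_disjoint d1 (f := g) ih (h N)
    have d2 : Disjoint (ratIoc N ∪ Set.Ioo ((N : ℤ) : ℚ) b) {b} := by
      rw [Set.disjoint_singleton_right]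
      rintro (hr | hr)
      · have := hr.2
        rw [hb'] at this
        linarith
      · exact lt_irrefl _ hr.2
    have h3 := HasSum.add_disjoint d2 (f := g) h2 h1
    have e : ratIoc (N + 1) = ratIoc N ∪ Set.Ioo ((N : ℤ) : ℚ) b ∪ {b} := by
      have h0 : (0 : ℚ) ≤ N := N.cast_nonneg
      ext r
      simp only [ratIoc, Set.mem_Ioc, Set.mem_union, Set.mem_Ioo, Set.mem_singleton_iff, hN, hb']
      push_cast
      constructor
      · rintro ⟨r0, r1⟩
        rcases le_or_gt r N with h | h
        · exact Or.inl (Or.inl ⟨r0, h⟩)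
        · rcases r1.lt_or_eq with h' | h'
          · exact Or.inl (Or.inr ⟨h, h'⟩)
          · exact Or.inr h'
      · rintro ((⟨h, h'⟩ | ⟨h, h'⟩) | h)
        · exact ⟨h, by linarith⟩
        · exact ⟨by linarith, h'.le⟩
        · exact ⟨by linarith, h.le⟩
    rw [e]
    exact h3

section Strip

variable {μ : ℂ} {φ : Region → ℂ} {t : ℝ}

theorem two_lt_norm (hΩ : sublevel φ 2 = {OnePoint.infty}) (r : ℚ) :
    2 < ‖φ (r : Region)‖ := by
  by_contra! h
  have : (r : Region) ∈ sublevel φ 2 := h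
  rw [hΩ] at this
  exact OnePoint.coe_ne_infty r this

/-- Consecutive neighbors of `∞` satisfy `y (n-1) y (n+1) = y n ^ 2 + t ^ 2 - μ`, and the left
side exceeds `4` in modulus. -/
theorem le_norm_int_sq_sub (hφ : IsMarkoffMap μ φ) (hΩ : sublevel φ 2 = {OnePoint.infty})
    (hφt : φ OnePoint.infty = (t : ℂ)) (n : ℤ) :
    4 - t ^ 2 ≤ ‖φ ((n : ℚ) : Region) ^ 2 - μ‖ := by
  have key : ∀ n : ℤ, 4 - t ^ 2 ≤ ‖φ (((n + 1 : ℤ) : ℚ) : Region) ^ 2 - μ‖ := by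
    intro n
    have e1 := hφ.edge_infty n
    have e2 := hφ.vertex_infty n
    rw [hφt] at e1 e2
    have h0 := two_lt_norm hΩ n
    have h2 := two_lt_norm hΩ ((n + 1 + 1 : ℤ) : ℚ)
    set y0 := φ ((n : ℚ) : Region)
    set y1 := φ (((n + 1 : ℤ) : ℚ) : Region)
    set y2 := φ (((n + 1 + 1 : ℤ) : ℚ) : Region)
    have e : y0 * y2 = (y1 ^ 2 - μ) + (t : ℂ) ^ 2 := by linear_combination (-y0) * e1 - e2
    have h3 := norm_add_le (y1 ^ 2 - μ) ((t : ℂ) ^ 2)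
    rw [← e, norm_mul, norm_pow, Complex.norm_real, Real.norm_eq_abs, sq_abs] at h3
    nlinarith
  simpa using key (n - 1)

theorem exists_tamePair_int (hφ : IsMarkoffMap μ φ) (hΩ : sublevel φ 2 = {OnePoint.infty})
    (ht : t ∈ Set.Ioo (-2 : ℝ) 2) (hφt : φ OnePoint.infty = (t : ℂ)) (n : ℤ) :
    ∃ δ c : ℝ, 1 < δ ∧ 0 < c ∧ c ≤ 2 * (δ - 1) ∧
      TamePair μ φ δ c (n : ℚ) ((n + 1 : ℤ) : ℚ) := by
  have h0 := two_lt_norm hΩ n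
  have h1 := two_lt_norm hΩ ((n + 1 : ℤ) : ℚ)
  have hδ : 1 < min ‖φ ((n : ℚ) : Region)‖ ‖φ (((n + 1 : ℤ) : ℚ) : Region)‖ / 2 := by
    rw [lt_div_iff₀ (by norm_num), one_mul]; exact lt_min h0 h1
  have ht2 : t ^ 2 < 4 := by nlinarith [ht.1, ht.2]
  refine ⟨_, min (2 * (min ‖φ ((n : ℚ) : Region)‖ ‖φ (((n + 1 : ℤ) : ℚ) : Region)‖ / 2 - 1))
    (4 - t ^ 2), hδ, lt_min (by linarith) (by linarith), min_le_left _ _,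
    ⟨⟨fareyPair_int n, ?_, ?_, ?_⟩, (min_le_right _ _).trans (le_norm_int_sq_sub hφ hΩ hφt n),
    (min_le_right _ _).trans (le_norm_int_sq_sub hφ hΩ hφt (n + 1))⟩⟩
  · rw [Rat.den_intCast, pow_one, mul_div_cancel₀ _ two_ne_zero]
    exact min_le_left _ _
  · rw [Rat.den_intCast, pow_one, mul_div_cancel₀ _ two_ne_zero]
    exact min_le_right _ _
  · rw [hφ.edge_int n, add_sub_cancel_right, hφt, Complex.norm_real, Real.norm_eq_abs]
    exact (abs_le.2 ⟨ht.1.le, ht.2.le⟩).trans (two_lt_norm hΩ _).le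

theorem sq_ne (hφ : IsMarkoffMap μ φ) (hΩ : sublevel φ 2 = {OnePoint.infty})
    (ht : t ∈ Set.Ioo (-2 : ℝ) 2) (hφt : φ OnePoint.infty = (t : ℂ)) (r : ℚ) :
    φ (r : Region) ^ 2 ≠ μ := by
  intro h
  have ht2 : t ^ 2 < 4 := by nlinarith [ht.1, ht.2]
  rcases (Int.floor_le r).eq_or_lt with hr | hr
  · have := le_norm_int_sq_sub hφ hΩ hφt ⌊r⌋
    rw [hr, h, sub_self, norm_zero] at this
    linarith
  · obtain ⟨δ, c, hδ, hc0, hc, hT⟩ := exists_tamePair_int hφ hΩ ht hφt ⌊r⌋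
    have hr' : r < ((⌊r⌋ + 1 : ℤ) : ℚ) := by push_cast; exact Int.lt_floor_add_one r
    obtain ⟨a, b, hab, rfl⟩ := (TamePair.hereditary hφ hδ hc).exists_eq_mediant hT hr hr'
    have := hab.toGrowthPair.le_norm_sq_sub hφ hδ
    rw [h, sub_self, norm_zero] at this
    linarith

theorem edgeRatio_int (hφ : IsMarkoffMap μ φ) (hΩ : sublevel φ 2 = {OnePoint.infty})
    (hφt : φ OnePoint.infty = (t : ℂ)) (n : ℤ) :
    edgeRatio φ (n : ℚ) ((n + 1 : ℤ) : ℚ) =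
      t / (φ ((n : ℚ) : Region) * φ (((n + 1 : ℤ) : ℚ) : Region)) := by
  have h0 : φ ((n : ℚ) : Region) ≠ 0 := norm_pos_iff.1 (by linarith [two_lt_norm hΩ n])
  have h1 : φ (((n + 1 : ℤ) : ℚ) : Region) ≠ 0 :=
    norm_pos_iff.1 (by linarith [two_lt_norm hΩ ((n + 1 : ℤ) : ℚ)])
  have e := hφ.edge_int n
  rw [hφt] at e
  unfold edgeRatio
  rw [one_sub_div (mul_ne_zero h0 h1), e, add_sub_cancel_right]

/-- The values at the integers `0, 1, 2, …`, the neighbors of `∞`. -/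
def intValue (φ : Region → ℂ) (n : ℕ) : ℂ := φ (((n : ℤ) : ℚ) : Region)

theorem intValue_recurrence (hφ : IsMarkoffMap μ φ) (hφt : φ OnePoint.infty = (t : ℂ)) {θ : ℝ}
    (hθ : t = 2 * Real.cos θ) (n : ℕ) : intValue φ (n + 2) =
      ((2 * Real.cos θ : ℝ) : ℂ) * intValue φ (n + 1) - intValue φ n := by
  have := hφ.edge_infty (n : ℤ)
  rw [hφt] at this
  rw [← hθ]
  unfold intValue
  push_cast at this ⊢
  rw [this, add_assoc]
  norm_num

/-- The sequence `S` of partial sums of `g` has bounded real part, and `exp ∘ S` returns to `1`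
along a subsequence. -/
def RecurrentSums (g : ℚ → ℂ) : Prop :=
  ∃ S : ℕ → ℂ, (∀ N, HasSum (fun r : ratIoc N => g r) (S N)) ∧
    (∃ M : ℝ, ∀ N, |(S N).re| ≤ M) ∧
    ∃ n : ℕ → ℕ, StrictMono n ∧ (∀ k, 0 < n k) ∧
      Tendsto (fun k => Complex.exp (S (n k))) atTop (𝓝 1)

theorem RecurrentSums.neg {g : ℚ → ℂ} (h : RecurrentSums g) : RecurrentSums fun r => -g r := by
  obtain ⟨S, h1, ⟨M, h2⟩, n, h3, h4, h5⟩ := h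
  refine ⟨fun N => -S N, fun N => (h1 N).neg, ⟨M, fun N => ?_⟩, n, h3, h4, ?_⟩
  · rw [Complex.neg_re, abs_neg]; exact h2 N
  · have := h5.inv₀ one_ne_zero
    rw [inv_one] at this
    exact this.congr fun k => (Complex.exp_neg _).symm

/-- For `μ = 0` the sums telescope to `b N - b 0` with `b n = y (n+1) / (t y n) + h (y n)`. The first
term vanishes for `t = 0`, by the convention on division, and the formula remains correct. -/
theorem recurrentSums_gapH (hφ : IsMarkoffMap μ φ) (hΩ : sublevel φ 2 = {OnePoint.infty})
    (ht : t ∈ Set.Ioo (-2 : ℝ) 2) (hφt : φ OnePoint.infty = (t : ℂ)) (hμ : μ = 0)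
    {θ : ℝ} (hθ : t = 2 * Real.cos θ) (hsin : 0 < Real.sin θ) :
    RecurrentSums fun r => gapH (φ (r : Region)) := by
  set y := intValue φ with hy
  have hrec := intValue_recurrence hφ hφt hθ
  have hy2 : ∀ n, 2 < ‖y n‖ := fun n => two_lt_norm hΩ _
  have hy0 : ∀ n, y n ≠ 0 := fun n => norm_pos_iff.1 (by linarith [hy2 n])
  set b : ℕ → ℂ := fun n => y (n + 1) / (t * y n) + gapH (y n) with hb
  have hT : ∀ n : ℕ, HasSum (fun r : Set.Ioo (((n : ℤ)) : ℚ) (((n : ℤ) + 1 : ℤ) : ℚ) =>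
      2 * gapH (φ ((r : ℚ) : Region)))
      (edgeDefect φ (((n : ℤ)) : ℚ) (((n : ℤ) + 1 : ℤ) : ℚ)) := by
    intro n
    obtain ⟨δ, c, hδ, hc0, hc, h⟩ := exists_tamePair_int hφ hΩ ht hφt n
    exact hasSum_two_mul_gapH hφ hμ hδ hc h
  have hstep : ∀ n : ℕ, edgeDefect φ (((n : ℤ)) : ℚ) (((n : ℤ) + 1 : ℤ) : ℚ) +
      2 * gapH (φ ((((n : ℤ) + 1 : ℤ) : ℚ) : Region)) = b (n + 1) - b n := by
    intro n
    have e0 : φ (((n : ℤ) : ℚ) : Region) = y n := rfl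
    have e1 : φ ((((n : ℤ) + 1 : ℤ) : ℚ) : Region) = y (n + 1) := by
      rw [hy, intValue]; norm_num
    have hv := hφ.vertex_infty (n : ℤ)
    unfold edgeDefect
    rw [edgeRatio_int hφ hΩ hφt]
    rw [e0, e1, hφt, hμ] at *
    have hr : y (n + 1 + 1) = t * y (n + 1) - y n := by rw [hθ]; exact hrec n
    have h0 := hy0 n
    have h1 := hy0 (n + 1)
    have key : (t : ℂ) / (y n * y (n + 1)) =
        y (n + 1 + 1) / (t * y (n + 1)) - y (n + 1) / (t * y n) := by
      rcases eq_or_ne (t : ℂ) 0 with h | h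
      · simp [h]
      · rw [hr]
        field_simp
        linear_combination hv
    simp only [hb]
    rw [key]
    ring
  have hS : ∀ N, HasSum (fun r : ratIoc N => gapH (φ ((r : ℚ) : Region)))
      ((b N - b 0) / 2) := by
    intro N
    have h1 := (hasSum_ratIoc (g := fun r => 2 * gapH (φ (r : Region))) hT N).div_const 2
    rw [Finset.sum_congr rfl fun n _ => hstep n, Finset.sum_range_sub] at h1
    simpa using h1
  obtain ⟨M, hM0, hM⟩ := exists_norm_le_of_recurrence hsin hrec
  have hbb : ∀ n, ‖b n‖ ≤ M / (|t| * 2) + 1 / 2 := by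
    intro n
    refine (norm_add_le _ _).trans (add_le_add ?_ (norm_gapH_le_half (hy2 n).le))
    rw [norm_div, norm_mul, Complex.norm_real, Real.norm_eq_abs]
    rcases eq_or_ne t 0 with h | h
    · simp [h]
    · have := abs_pos.2 h
      exact div_le_div₀ hM0.le (hM _) (by positivity)
        (mul_le_mul_of_nonneg_left (hy2 n).le this.le)
  obtain ⟨n, hn, hn0, hc, hs⟩ := exists_strictMono_tendsto_cos_sin θ
  refine ⟨_, hS, ⟨M / (|t| * 2) + 1 / 2, fun N => ?_⟩, n, hn, hn0, ?_⟩
  · refine (Complex.abs_re_le_norm _).trans ?_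
    rw [norm_div, Complex.norm_ofNat, div_le_iff₀ (by norm_num)]
    linarith [norm_sub_le (b N) (b 0), hbb N, hbb 0]
  · have h0 := tendsto_zero_of_recurrence hsin hrec hc hs
    have h1 := tendsto_zero_of_recurrence (u := fun n => y (n + 1)) hsin
      (fun n => hrec (n + 1)) hc hs
    have hbl : Tendsto (fun k => b (n k)) atTop (𝓝 (b 0)) := by
      refine Tendsto.add ?_ ((continuousAt_gapH (hy2 0)).tendsto.comp h0)
      rcases eq_or_ne (t : ℂ) 0 with h | h
      · simp [h]
      · exact h1.div (h0.const_mul _) (mul_ne_zero h (hy0 0))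
    have := (Complex.continuous_exp.tendsto _).comp ((hbl.sub_const (b 0)).div_const 2)
    rwa [sub_self, zero_div, Complex.exp_zero] at this

/-- For `μ ≠ 0` the exponentials of the sums telescope to `B N / B 0` with
`B n = K n / (y n H_{ω⁻¹}(y n))` and `K n = t y n + (ω - 1) y (n+1)`. The sequence `K` satisfies the
recurrence of `y`, so it vanishes identically or is bounded away from zero. -/
theorem recurrentSums_of_exp_eq (hφ : IsMarkoffMap μ φ) (hΩ : sublevel φ 2 = {OnePoint.infty})
    (ht : t ∈ Set.Ioo (-2 : ℝ) 2) (hφt : φ OnePoint.infty = (t : ℂ))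
    {θ : ℝ} (hθ : t = 2 * Real.cos θ) (hsin : 0 < Real.sin θ) {ω : ℂ} (hω : ω ≠ 0)
    (hμ : ω + ω⁻¹ = 2 - μ) {g : ℚ → ℂ}
    (hg : ∀ r : ℚ, Complex.exp (g r) =
      gapFactor ω (φ (r : Region)) / gapFactor ω⁻¹ (φ (r : Region)))
    (hsum : ∀ n : ℤ, Summable fun r : Set.Ioo (n : ℚ) ((n + 1 : ℤ) : ℚ) => g r)
    (hK0 : (t : ℂ) * intValue φ 0 + (ω - 1) * intValue φ 1 ≠ 0) : RecurrentSums g := by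
  set y := intValue φ with hy
  have hrec := intValue_recurrence hφ hφt hθ
  rw [← hy] at hrec
  have hy2 : ∀ n, 2 < ‖y n‖ := fun n => two_lt_norm hΩ _
  have hy0 : ∀ n, y n ≠ 0 := fun n => norm_pos_iff.1 (by linarith [hy2 n])
  have ht2 : 0 < 4 - t ^ 2 := by nlinarith [ht.1, ht.2]
  have hyμ : ∀ n, 4 - t ^ 2 ≤ ‖y n ^ 2 - μ‖ := fun n => le_norm_int_sq_sub hφ hΩ hφt n
  have hyμ' : ∀ n, y n ^ 2 ≠ μ := fun n => sq_ne hφ hΩ ht hφt _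
  have hμ' : ω⁻¹ + ω⁻¹⁻¹ = 2 - μ := by rw [inv_inv, add_comm, hμ]
  have hF : ∀ n, gapFactor ω (y n) ≠ 0 := fun n => gapFactor_ne_zero hω hμ (hy0 n) (hyμ' n)
  have hF' : ∀ n, gapFactor ω⁻¹ (y n) ≠ 0 := fun n =>
    gapFactor_ne_zero (inv_ne_zero hω) hμ' (hy0 n) (hyμ' n)
  have e2 : (ω - 1) ^ 2 = -μ * ω := by
    have h := hμ
    field_simp at h
    linear_combination h
  set K : ℕ → ℂ := fun n => (t : ℂ) * y n + (ω - 1) * y (n + 1) with hK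
  have hKrec : ∀ n, K (n + 2) = ((2 * Real.cos θ : ℝ) : ℂ) * K (n + 1) - K n := by
    intro n
    simp only [hK]
    rw [hrec (n + 1), hrec n]
    ring
  -- the vertex relation at `(∞, n, n + 1)`; it remains valid for `t = 0`
  have hKstep : ∀ n, (y n * y (n + 1) + (ω - 1) * t) * K n = (y n ^ 2 - μ) * K (n + 1) := by
    intro n
    have hv : (t : ℂ) ^ 2 + y n ^ 2 + y (n + 1) ^ 2 - t * y n * y (n + 1) = μ := by
      have := hφ.vertex_infty (n : ℤ)
      rw [hφt] at this
      simpa [hy, intValue] using this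
    have hr : y (n + 1 + 1) = t * y (n + 1) - y n := by rw [hθ]; exact hrec n
    simp only [hK]
    rw [hr]
    linear_combination ((ω - 1) * y n) * hv + ((t : ℂ) * y (n + 1)) * e2
  have hT : ∀ n : ℕ, ∃ T,
      HasSum (fun r : Set.Ioo (((n : ℤ)) : ℚ) (((n : ℤ) + 1 : ℤ) : ℚ) => g r) T ∧
      Complex.exp T = edgeWeight ω φ (((n : ℤ)) : ℚ) (((n : ℤ) + 1 : ℤ) : ℚ) := by
    intro n
    obtain ⟨δ, c, hδ, hc0, hc, h⟩ := exists_tamePair_int hφ hΩ ht hφt n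
    exact exists_hasSum_exp_eq_edgeWeight hφ hδ hc0 hc hω hμ hg h (hsum n)
  choose T hT1 hT2 using hT
  set B : ℕ → ℂ := fun n => K n / (y n * gapFactor ω⁻¹ (y n)) with hB
  set S : ℕ → ℂ := fun N => ∑ n ∈ Finset.range N, (T n + g (((n : ℤ) + 1 : ℤ) : ℚ)) with hS
  have hstep : ∀ n : ℕ, Complex.exp (T n + g (((n : ℤ) + 1 : ℤ) : ℚ)) * B n = B (n + 1) := by
    intro n
    have e0 : φ (((n : ℤ) : ℚ) : Region) = y n := rfl
    have e1 : φ ((((n : ℤ) + 1 : ℤ) : ℚ) : Region) = y (n + 1) := by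
      rw [hy, intValue]; norm_num
    rw [Complex.exp_add, hT2, hg]
    unfold edgeWeight
    rw [edgeRatio_int hφ hΩ hφt, e0, e1]
    simp only [hB]
    have hks := hKstep n
    have hD : gapFactor ω (y n) * gapFactor ω⁻¹ (y n) * y n ^ 2 = y n ^ 2 - μ := by
      rw [gapFactor_mul_inv hω hμ (hy0 n), sub_mul, one_mul,
        div_mul_cancel₀ _ (pow_ne_zero 2 (hy0 n))]
    rw [← hD] at hks
    have a0 := hy0 n
    have a1 := hy0 (n + 1)
    have a2 := hF n
    have a3 := hF (n + 1)
    have a4 := hF' n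
    have a5 := hF' (n + 1)
    generalize gapFactor ω⁻¹ (y n) = f' at *
    generalize gapFactor ω⁻¹ (y (n + 1)) = g' at *
    field_simp
    linear_combination hks
  have hexp : ∀ N, Complex.exp (S N) * B 0 = B N := by
    intro N
    induction N with
    | zero => simp [hS]
    | succ N ih =>
      rw [← hstep N, ← ih, hS]
      simp only [Finset.sum_range_succ]
      rw [Complex.exp_add]
      ring
  have hB0 : B 0 ≠ 0 := div_ne_zero hK0 (mul_ne_zero (hy0 0) (hF' 0))
  have hexp' : ∀ N, Complex.exp (S N) = B N / B 0 := fun N => by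
    rw [← hexp N, mul_div_cancel_right₀ _ hB0]
  -- bounds on `B`
  obtain ⟨M, hM0, hM⟩ := exists_norm_le_of_recurrence hsin hrec
  obtain ⟨MK, hMK0, hMK⟩ := exists_norm_le_of_recurrence hsin hKrec
  set m : ℝ := 1 / (1 + ‖μ‖ / (4 - t ^ 2)) / (1 + ‖ω⁻¹⁻¹ - 1‖) with hm
  have hm0 : 0 < m := by positivity
  have hlow : ∀ n, m ≤ ‖gapFactor ω⁻¹ (y n)‖ := fun n =>
    le_norm_gapFactor (inv_ne_zero hω) hμ' ht2 (hy2 n).le (hyμ n)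
  have hup : ∀ n, ‖gapFactor ω⁻¹ (y n)‖ ≤ 1 + ‖ω⁻¹ - 1‖ := fun n =>
    norm_gapFactor_le (hy2 n).le
  set C : ℝ := (M * M + ‖ω - 1‖ * |t|) / (4 - t ^ 2) with hC
  have hC0 : 0 ≤ C := by positivity
  -- a small `K n` forces a small `K (n + 1)`, hence a small `K 0`
  have hKlow : ∀ n, ‖K 0‖ * Real.sin θ / (1 + C) ≤ ‖K n‖ := by
    intro n
    rw [div_le_iff₀ (by positivity)]
    refine (norm_zero_mul_sin_le hsin hKrec n).trans ?_
    have h1 := congrArg norm (hKstep n)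
    rw [norm_mul, norm_mul] at h1
    have h2 : ‖y n * y (n + 1) + (ω - 1) * t‖ ≤ M * M + ‖ω - 1‖ * |t| := by
      refine (norm_add_le _ _).trans ?_
      rw [norm_mul, norm_mul, Complex.norm_real, Real.norm_eq_abs]
      exact add_le_add (mul_le_mul (hM _) (hM _) (norm_nonneg _) hM0.le) le_rfl
    have h3 : ‖K (n + 1)‖ ≤ C * ‖K n‖ := by
      rw [hC, div_mul_eq_mul_div, le_div_iff₀ ht2]
      calc ‖K (n + 1)‖ * (4 - t ^ 2) ≤ ‖K (n + 1)‖ * ‖y n ^ 2 - μ‖ :=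
            mul_le_mul_of_nonneg_left (hyμ n) (norm_nonneg _)
        _ = ‖y n * y (n + 1) + (ω - 1) * t‖ * ‖K n‖ := by rw [h1, mul_comm]
        _ ≤ _ := mul_le_mul_of_nonneg_right h2 (norm_nonneg _)
    linarith
  set κ : ℝ := ‖K 0‖ * Real.sin θ / (1 + C) with hκ
  have hκ0 : 0 < κ := by
    have : 0 < ‖K 0‖ := norm_pos_iff.2 hK0
    positivity
  have hBup : ∀ n, ‖B n‖ ≤ MK / (2 * m) := by
    intro n
    simp only [hB]
    rw [norm_div, norm_mul]
    exact div_le_div₀ hMK0.le (hMK n) (by positivity)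
      (mul_le_mul (hy2 n).le (hlow n) hm0.le (norm_nonneg _))
  have hBlow : ∀ n, κ / (M * (1 + ‖ω⁻¹ - 1‖)) ≤ ‖B n‖ := by
    intro n
    simp only [hB]
    rw [norm_div, norm_mul]
    exact div_le_div₀ (norm_nonneg _) (hKlow n)
      (mul_pos (norm_pos_iff.2 (hy0 n)) (norm_pos_iff.2 (hF' n)))
      (mul_le_mul (hM n) (hup n) (norm_nonneg _) hM0.le)
  have hlog : ∀ N, (S N).re = Real.log ‖B N‖ - Real.log ‖B 0‖ := by
    intro N
    have hBN : B N ≠ 0 := by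
      rw [← hexp N]; exact mul_ne_zero (Complex.exp_ne_zero _) hB0
    rw [← Real.log_div (norm_ne_zero_iff.2 hBN) (norm_ne_zero_iff.2 hB0), ← norm_div,
      ← hexp' N, Complex.norm_exp, Real.log_exp]
  obtain ⟨n, hn, hn0, hc, hs⟩ := exists_strictMono_tendsto_cos_sin θ
  refine ⟨S, hasSum_ratIoc hT1,
    ⟨Real.log (MK / (2 * m)) - Real.log (κ / (M * (1 + ‖ω⁻¹ - 1‖))), fun N => ?_⟩, n, hn, hn0, ?_⟩
  · have hlogB : ∀ N, Real.log (κ / (M * (1 + ‖ω⁻¹ - 1‖))) ≤ Real.log ‖B N‖ ∧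
        Real.log ‖B N‖ ≤ Real.log (MK / (2 * m)) := fun N =>
      ⟨Real.log_le_log (by positivity) (hBlow N),
        Real.log_le_log (lt_of_lt_of_le (by positivity) (hBlow N)) (hBup N)⟩
    rw [hlog, abs_le]
    constructor <;> linarith [(hlogB N).1, (hlogB N).2, (hlogB 0).1, (hlogB 0).2]
  · have h0 := tendsto_zero_of_recurrence hsin hrec hc hs
    have h1 := tendsto_zero_of_recurrence hsin hKrec hc hs
    have h2 : ContinuousAt (gapFactor ω⁻¹) (y 0) := by
      unfold gapFactor
      exact continuousAt_const.add (continuousAt_const.mul (continuousAt_gapH (hy2 0)))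
    have h3 : Tendsto (fun k => B (n k)) atTop (𝓝 (B 0)) :=
      h1.div (h0.mul (h2.tendsto.comp h0)) (mul_ne_zero (hy0 0) (hF' 0))
    have h4 := h3.div_const (B 0)
    rw [div_self hB0] at h4
    exact h4.congr fun k => (hexp' _).symm

theorem exp_nu_add_inv (μ : ℂ) : Complex.exp (nu μ) + (Complex.exp (nu μ))⁻¹ = 2 - μ := by
  have := cosh_arccosh (1 - μ / 2)
  rw [Complex.cosh, Complex.exp_neg] at this
  unfold nu
  linear_combination 2 * this

theorem recurrentSums_gap (hμ4 : μ ≠ 4) (hφ : IsMarkoffMap μ φ)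
    (hΩ : sublevel φ 2 = {OnePoint.infty}) (ht : t ∈ Set.Ioo (-2 : ℝ) 2)
    (hφt : φ OnePoint.infty = (t : ℂ)) : RecurrentSums fun r => gap μ (φ (r : Region)) := by
  have ht1 : |t / 2| < 1 := by
    rw [abs_lt]; constructor <;> linarith [ht.1, ht.2]
  have hcos : Real.cos (Real.arccos (t / 2)) = t / 2 :=
    Real.cos_arccos (abs_lt.1 ht1).1.le (abs_lt.1 ht1).2.le
  have hθ : t = 2 * Real.cos (Real.arccos (t / 2)) := by rw [hcos]; ring
  have hsin : 0 < Real.sin (Real.arccos (t / 2)) := by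
    rw [Real.sin_arccos]
    refine Real.sqrt_pos.2 ?_
    rw [sub_pos, sq_lt_one_iff_abs_lt_one]
    exact ht1
  rcases eq_or_ne μ 0 with hμ | hμ
  · simpa [gap, hμ] using recurrentSums_gapH hφ hΩ ht hφt hμ hθ hsin
  set ω := Complex.exp (nu μ) with hω
  have hω0 : ω ≠ 0 := Complex.exp_ne_zero _
  have hsum := exp_nu_add_inv μ
  rw [← hω] at hsum
  have hsum' : ω⁻¹ + ω⁻¹⁻¹ = 2 - μ := by rw [inv_inv, add_comm, hsum]
  have hgap : (fun r : ℚ => gap μ (φ (r : Region))) = fun r : ℚ =>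
      Complex.log (gapFactor ω (φ (r : Region)) / gapFactor ω⁻¹ (φ (r : Region))) := by
    funext r
    rw [gap, if_neg hμ, gapTau, Complex.exp_neg, ← hω]
    rfl
  rw [hgap]
  have hlog : ∀ n : ℤ, Summable fun r : Set.Ioo (n : ℚ) ((n + 1 : ℤ) : ℚ) =>
      Complex.log (gapFactor ω (φ ((r : ℚ) : Region)) / gapFactor ω⁻¹ (φ ((r : ℚ) : Region))) := by
    intro n
    obtain ⟨δ, c, hδ, hc0, hc, h⟩ := exists_tamePair_int hφ hΩ ht hφt n
    exact summable_log_gapFactor hφ hδ hc0 hc hω0 hsum h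
  have hy0 : ∀ r : ℚ, φ (r : Region) ≠ 0 := fun r =>
    norm_pos_iff.1 (by linarith [two_lt_norm hΩ r])
  have hF : ∀ r : ℚ, gapFactor ω (φ (r : Region)) ≠ 0 := fun r =>
    gapFactor_ne_zero hω0 hsum (hy0 r) (sq_ne hφ hΩ ht hφt r)
  have hF' : ∀ r : ℚ, gapFactor ω⁻¹ (φ (r : Region)) ≠ 0 := fun r =>
    gapFactor_ne_zero (inv_ne_zero hω0) hsum' (hy0 r) (sq_ne hφ hΩ ht hφt r)
  by_cases hK : (t : ℂ) * intValue φ 0 + (ω - 1) * intValue φ 1 = 0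
  · -- the boundary factor for `ω` vanishes; the one for `ω⁻¹` does not, as `ω² ≠ 1`
    have hK' : (t : ℂ) * intValue φ 0 + (ω⁻¹ - 1) * intValue φ 1 ≠ 0 := by
      intro hK'
      have h1 : (ω - ω⁻¹) * intValue φ 1 = 0 := by linear_combination hK - hK'
      have h2 : ω - ω⁻¹ = 0 := (mul_eq_zero.1 h1).resolve_right (hy0 _)
      have h3 : (ω - 1) * (ω + 1) = 0 := by
        have := mul_inv_cancel₀ hω0
        linear_combination ω * h2 + this
      rcases mul_eq_zero.1 h3 with h | h
      · rw [sub_eq_zero.1 h, inv_one] at hsum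
        apply hμ
        linear_combination hsum
      · rw [eq_neg_of_add_eq_zero_left h, inv_neg, inv_one] at hsum
        apply hμ4
        linear_combination hsum
    have := (recurrentSums_of_exp_eq hφ hΩ ht hφt hθ hsin (inv_ne_zero hω0) hsum'
      (g := fun r : ℚ => -Complex.log (gapFactor ω (φ (r : Region)) /
        gapFactor ω⁻¹ (φ (r : Region)))) (fun r => by
          rw [Complex.exp_neg, Complex.exp_log (div_ne_zero (hF r) (hF' r)), inv_div, inv_inv])
      (fun n => (hlog n).neg) hK').neg
    simpa using this
  · exact recurrentSums_of_exp_eq hφ hΩ ht hφt hθ hsin hω0 hsum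
      (fun r => Complex.exp_log (div_ne_zero (hF r) (hF' r))) hlog hK

end Strip

end MarkoffMap

theorem theorem2p6 (μ : ℂ) (hμ : μ ≠ 4) (φ : MarkoffMap.Region → ℂ)
    (hφ : MarkoffMap.IsMarkoffMap μ φ)
    (hΩ : MarkoffMap.sublevel φ 2 = {OnePoint.infty})
    (hreal : ∃ t : ℝ, t ∈ Set.Ioo (-2 : ℝ) 2 ∧ φ OnePoint.infty = (t : ℂ)) :
    (∀ r : ℚ, φ (r : MarkoffMap.Region) ≠ 0 ∧ φ (r : MarkoffMap.Region) ^ 2 ≠ μ) ∧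
    (∀ N : ℕ, Summable fun r : MarkoffMap.ratIoc N =>
      ‖MarkoffMap.gap μ (φ ((r : ℚ) : MarkoffMap.Region))‖) ∧
    Filter.Tendsto (fun N : ℕ => (MarkoffMap.gapSum μ φ N / (N : ℂ)).re)
      Filter.atTop (nhds 0) ∧
    ∃ n : ℕ → ℕ, StrictMono n ∧ (∀ k, 0 < n k) ∧
      ∃ m : ℕ → ℤ, Filter.Tendsto
        (fun k => MarkoffMap.gapSum μ φ (n k) - (m k : ℂ) * (2 * (Real.pi : ℂ) * Complex.I))
        Filter.atTop (nhds 0) := by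
  obtain ⟨t, ht, hφt⟩ := hreal
  obtain ⟨S, hS, ⟨M, hM⟩, n, hn, hn0, hlim⟩ :=
    MarkoffMap.recurrentSums_gap hμ hφ hΩ ht hφt
  have hgs : ∀ N, MarkoffMap.gapSum μ φ N = S N := fun N => (hS N).tsum_eq
  refine ⟨fun r => ⟨norm_pos_iff.1 (by linarith [MarkoffMap.two_lt_norm hΩ r]),
    MarkoffMap.sq_ne hφ hΩ ht hφt r⟩, fun N => (hS N).summable.norm, ?_, n, hn, hn0, ?_⟩
  · refine squeeze_zero_norm (a := fun N : ℕ => M / (N : ℝ)) (fun N => ?_)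
      (tendsto_const_div_atTop_nhds_zero_nat M)
    rw [hgs, Complex.div_natCast_re, norm_div, Real.norm_eq_abs, Real.norm_eq_abs, Nat.abs_cast]
    exact div_le_div_of_nonneg_right (hM N) N.cast_nonneg
  · have key : ∀ k, ∃ m : ℤ, S (n k) =
        Complex.log (Complex.exp (S (n k))) + m * (2 * (Real.pi : ℂ) * Complex.I) := fun k =>
      Complex.exp_eq_exp_iff_exists_int.1 (Complex.exp_log (Complex.exp_ne_zero _)).symm
    choose m hm using key
    refine ⟨m, ?_⟩
    have h := (continuousAt_clog Complex.one_mem_slitPlane).tendsto.comp hlim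
    rw [Complex.log_one] at h
    refine h.congr fun k => ?_
    rw [hgs, Function.comp_apply]
    linear_combination -hm k
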